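/- Let $a_0,a_1,a_2,\dots$ be i.i.d. standard complex Gaussian random variables on a probability space (mean $0$, $\mathbb E|a_j|^2=1$, that is, with density $\frac1\pi e^{-|w|^2}$ with respect to Lebesgue measure on $\mathbb C$), and for $n\ge 1$ let $$p_n(z)=\sum_{j=0}^n a_j\sqrt{\binom nj}\,z^j .$$ Let $\mathcal C_{p_n}=\sum_{z\in\mathbb C:\ p_n'(z)=0}\delta_{p_n(z)}$ be the empirical measure of the critical values of $p_n$. Then for every $n\ge1$ its expectation has a continuous density $\mathbb D_{p_n}:\mathbb C\to\mathbb R$ with respect to Lebesgue measure $d\ell$ on $\mathbb C$, in the sense that for every $\phi\in C_c^\infty(\mathbb R^2)$ the random variable $\sum_{z:\,p_n'(z)=0}\phi(p_n(z))$ is integrable and $$\mathbb E\sum_{z:\ p_n'(z)=0}\phi(p_n(z))=\int_{\mathbb C}\phi(x)\,\mathbb D_{p_n}(x)\,d\ell_x .$$ The continuous densities satisfy, for every $x\in\mathbb C$, $$\mathbb D_{p_n}(x)=\frac{1-e^{-|x|^2}}{\pi|x|^2}+\frac1\pi\int_0^1 e^{-(s-s\log s)|x|^2}\,ds+o(1)\qquad\text{as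 } n\to\infty,$$ where at $x=0$ the first term is understood as its limit $\frac1\pi$. -/

import Mathlib

open MeasureTheory ProbabilityTheory Filter Topology Polynomial

noncomputable section

/-- The standard complex Gaussian law (mean `0`, `E|a|^2 = 1`): the measure on `ℂ` with density
`π⁻¹ exp(-|z|^2)` with respect to Lebesgue measure. -/
def stdComplexGaussian : Measure ℂ :=
  (volume : Measure ℂ).withDensity
    (fun z => ENNReal.ofReal (Real.pi⁻¹ * Real.exp (-‖z‖ ^ 2)))

/-- The `SU(2)` polynomial `∑_{j = 0}^n c_j √(n choose j) z^j` with coefficient sequence `c`. -/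
def su2Poly (n : ℕ) (c : ℕ → ℂ) : ℂ[X] :=
  ∑ j ∈ Finset.range (n + 1), C (c j * (Real.sqrt (n.choose j : ℝ) : ℂ)) * X ^ j

/-- The set of critical points `{z : p'(z) = 0}`, each point listed once
(the empty set if `p'` is the zero polynomial, which for the random polynomials of degree
`n ≥ 1` is an event of probability zero). -/
def critPoints (p : ℂ[X]) : Finset ℂ := p.derivative.roots.toFinset

theorem mem_critPoints {p : ℂ[X]} (hp : p.derivative ≠ 0) (z : ℂ) :
    z ∈ critPoints p ↔ p.derivative.eval z = 0 := by
  simp [critPoints, hp]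

/-- The empirical measure of critical values, `∑_{z : p'(z) = 0} δ_{p(z)}`. -/
def critValueMeasure (p : ℂ[X]) : Measure ℂ :=
  ∑ z ∈ critPoints p, Measure.dirac (p.eval z)

theorem integral_critValueMeasure (p : ℂ[X]) (φ : ℂ → ℝ) :
    ∫ w, φ w ∂(critValueMeasure p) = ∑ z ∈ critPoints p, φ (p.eval z) := by
  unfold critValueMeasure
  rw [integral_finsetSum_measure]
  · simp
  · intro z _
    exact integrable_dirac (by simp)

/-- `D` is a density, with respect to Lebesgue measure on `ℂ`, of the expectation of the random
measure `∑_{z : p'(z) = 0} δ_{p(z)}`, where `p = p(ω)` is a random polynomial: for every smooth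
compactly supported `φ`, the random variable `∑_{z : p'(z) = 0} φ(p(z))` has a finite expectation,
equal to `∫ φ(x) D(x) dx`. -/
def IsExpectedCritDensity {Ω : Type*} [MeasurableSpace Ω] (P : Measure Ω)
    (p : Ω → ℂ[X]) (D : ℂ → ℝ) : Prop :=
  LocallyIntegrable D volume ∧
  ∀ φ : ℂ → ℝ, ContDiff ℝ (⊤ : ℕ∞) φ → HasCompactSupport φ →
    Integrable (fun ω => ∫ w, φ w ∂(critValueMeasure (p ω))) P ∧
    ∫ ω, (∫ w, φ w ∂(critValueMeasure (p ω))) ∂P = ∫ x, φ x * D x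

end

noncomputable section

open scoped ENNReal

/-! Write n = m + 1 and split the coefficients into a₁, a₀ and the vector v of the rest. The
equation p'(z) = 0 can be solved for a₁, so the critical points are the z-fibre of `critCoeff` over
a₁, and the map (z, v, a₀) ↦ (a₁, v, a₀) has real Jacobian |p''(z)|²/n. The area formula
(`fiber_area_formula`) therefore turns the expected sum over critical points into an integral over z
of the density of p(z) on {p'(z) = 0}, weighted by |p''(z)|²: this is the Kac-Rice formula
`lintegral_sum_critValue`.

The weighted density is explicit because the law of the Gaussian jet (p, p'/√n, p'') depends only on
its Hermitian form. Binomial moments write that form as three squares (`sum_norm_sq_dual_jetVec`),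
which amounts to a triangular Gaussian system. The density computed from the original coefficients
and the one computed from the triangular system agree almost everywhere, hence everywhere by
continuity (`integral_jetIntegrand_eq`), so p' = 0 may be substituted. The result `kacRice` depends
only on |z|² and |x|².

Put t = n|z|². The factor (1 + |z|²)^n becomes (1 + t/n)^n, which tends to exp t and dominates (1 +
t/2)² once n ≥ 2. Dominated convergence gives continuity in x and the pointwise limit. The limit
integrand splits into an exact derivative, which yields (1 - exp(-c))/c with c = |x|², and a term
that s = exp(-t) turns into the integral over [0, 1]. Since continuous densities are unique, the
limit holds for any choice of them. -/

/-! ### Area formula. -/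

/-- The inverse function theorem gives injectivity near each regular point, second countability
leaves countably many neighbourhoods, and `disjointed` separates them. -/
theorem exists_seq_injOn_cover {E : Type*} [NormedAddCommGroup E] [NormedSpace ℝ E]
    [FiniteDimensional ℝ E] [MeasurableSpace E] [BorelSpace E] {Φ : E → E}
    (hΦ : ContDiff ℝ 1 Φ) :
    ∃ B : ℕ → Set E, (∀ i, MeasurableSet (B i)) ∧ (∀ i, Set.InjOn Φ (B i)) ∧
      Pairwise (Function.onFun Disjoint B) ∧ ⋃ i, B i = {x | (fderiv ℝ Φ x).det ≠ 0} := by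
  have : CompleteSpace E := FiniteDimensional.complete ℝ E
  set S : Set E := {x | (fderiv ℝ Φ x).det ≠ 0} with hS
  have hSo : IsOpen S := by
    have h : Continuous fun x => (fderiv ℝ Φ x).det :=
      ContinuousLinearMap.continuous_det.comp (hΦ.continuous_fderiv (by simp))
    exact isOpen_ne_fun h continuous_const
  have hloc : ∀ x ∈ S, ∃ U, IsOpen U ∧ x ∈ U ∧ Set.InjOn Φ U := by
    intro x hx
    have hstrict : HasStrictFDerivAt Φ (fderiv ℝ Φ x) x :=
      hΦ.contDiffAt.hasStrictFDerivAt (by simp)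
    set e := ContinuousLinearMap.toContinuousLinearEquivOfDetNeZero (fderiv ℝ Φ x) hx with he
    have hstrict' : HasStrictFDerivAt Φ (e : E →L[ℝ] E) x := by
      simpa [he] using hstrict
    refine ⟨(hstrict'.toOpenPartialHomeomorph Φ).source,
      (hstrict'.toOpenPartialHomeomorph Φ).open_source,
      hstrict'.mem_toOpenPartialHomeomorph_source, ?_⟩
    have := (hstrict'.toOpenPartialHomeomorph Φ).injOn
    simpa using this
  choose! U hUo hxU hUi using hloc
  obtain ⟨t, htS, htc, hcov⟩ := TopologicalSpace.countable_cover_nhdsWithin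
    (f := U) (s := S) fun x hx => mem_nhdsWithin_of_mem_nhds ((hUo x hx).mem_nhds (hxU x hx))
  obtain ⟨V, hV, hVcov⟩ := (Set.exists_seq_cover_iff_countable
    (p := fun s : Set E => MeasurableSet s ∧ Set.InjOn Φ (s ∩ S)) ⟨∅, by simp⟩).2
    -- The critical set is added only so that the family covers the whole space; intersecting with
    -- `S` removes it again.
    ⟨insert Sᶜ (U '' t), (htc.image U).insert _, by
      rintro s (rfl | ⟨x, hx, rfl⟩)
      · exact ⟨hSo.measurableSet.compl, by simp⟩
      · exact ⟨(hUo x (htS hx)).measurableSet, (hUi x (htS hx)).mono Set.inter_subset_left⟩, by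
      rw [Set.sUnion_insert, Set.sUnion_image, Set.eq_univ_iff_forall]
      intro x
      by_cases hx : x ∈ S
      · exact Or.inr (hcov hx)
      · exact Or.inl hx⟩
  refine ⟨fun i => disjointed V i ∩ S, fun i =>
    (MeasurableSet.disjointed (fun j => (hV j).1) i).inter hSo.measurableSet,
    fun i => (hV i).2.mono (Set.inter_subset_inter_left _ (disjointed_subset V i)),
    fun i j hij => (disjoint_disjointed V hij).mono Set.inter_subset_left Set.inter_subset_left, ?_⟩
  rw [← Set.iUnion_inter, iUnion_disjointed, hVcov, Set.univ_inter]

/-- The area formula for a `C^1` self-map of a finite-dimensional space. -/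
theorem area_formula {E : Type*} [NormedAddCommGroup E] [NormedSpace ℝ E]
    [FiniteDimensional ℝ E] [MeasurableSpace E] [BorelSpace E] (μ : Measure E)
    [μ.IsAddHaarMeasure] {Φ : E → E} (hΦ : ContDiff ℝ 1 Φ) {F : E → ℝ≥0∞} (hF : Measurable F) :
    AEMeasurable (fun y => ∑' x : Φ ⁻¹' {y}, F x) μ ∧
      ∫⁻ y, ∑' x : Φ ⁻¹' {y}, F x ∂μ
        = ∫⁻ x, ENNReal.ofReal |(fderiv ℝ Φ x).det| * F x ∂μ := by
  have : CompleteSpace E := FiniteDimensional.complete ℝ E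
  obtain ⟨B, hBm, hBi, hBd, hBu⟩ := exists_seq_injOn_cover hΦ
  set S : Set E := {x | (fderiv ℝ Φ x).det ≠ 0} with hS
  have hd : ∀ x, HasFDerivAt Φ (fderiv ℝ Φ x) x := fun x =>
    (hΦ.differentiable (by simp) x).hasFDerivAt
  have hemb : ∀ i, MeasurableEmbedding ((B i).domRestrict Φ) := fun i =>
    hΦ.continuous.continuousOn.measurableEmbedding (hBm i) (hBi i)
  set G : ℕ → E → ℝ≥0∞ := fun i =>
    Function.extend ((B i).domRestrict Φ) (fun x : B i => F x) 0 with hG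
  have hGm : ∀ i, Measurable (G i) := fun i =>
    (hemb i).measurable_extend (hF.comp measurable_subtype_coe) measurable_const
  have hGin : ∀ i, ∀ x ∈ B i, G i (Φ x) = F x := fun i x hx =>
    (hemb i).injective.extend_apply (fun x : B i => F x) 0 ⟨x, hx⟩
  have hGout : ∀ i y, y ∉ Φ '' B i → G i y = 0 := by
    intro i y hy
    refine Function.extend_apply' _ _ _ ?_
    rintro ⟨x, rfl⟩
    exact hy ⟨x, x.2, rfl⟩
  -- Sard: critical values are null, so for almost every `y` the whole fibre lies in the union of
  -- the injectivity pieces.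
  have hcrit : μ (Φ '' Sᶜ) = 0 :=
    addHaar_image_eq_zero_of_det_fderivWithin_eq_zero μ
      (fun x _ => (hd x).hasFDerivWithinAt) fun x hx => by simpa [hS] using hx
  have hsum : (fun y => ∑' x : Φ ⁻¹' {y}, F x) =ᵐ[μ] fun y => ∑' i, G i y := by
    have h0 : ∀ᵐ y ∂μ, y ∉ Φ '' Sᶜ := measure_eq_zero_iff_ae_notMem.1 hcrit
    filter_upwards [h0] with y hy
    rw [tsum_subtype]
    have hpt : ∀ x, (Φ ⁻¹' {y}).indicator F x
        = ∑' i, (Φ ⁻¹' {y} ∩ B i).indicator F x := by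
      intro x
      by_cases hx : Φ x = y
      · have hxS : x ∈ ⋃ i, B i := by
          rw [hBu]; by_contra h; exact hy ⟨x, h, hx⟩
        obtain ⟨i, hi⟩ := Set.mem_iUnion.1 hxS
        rw [tsum_eq_single i]
        · rw [Set.indicator_of_mem (show x ∈ Φ ⁻¹' {y} from hx),
            Set.indicator_of_mem (show x ∈ Φ ⁻¹' {y} ∩ B i from ⟨hx, hi⟩)]
        · intro j hj
          refine Set.indicator_of_notMem (fun h => ?_) _
          exact Set.disjoint_left.1 (hBd hj) h.2 hi
      · rw [Set.indicator_of_notMem (show x ∉ Φ ⁻¹' {y} from hx)]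
        exact (ENNReal.tsum_eq_zero.2 fun i => Set.indicator_of_notMem (fun h => hx h.1) _).symm
    simp_rw [hpt]
    rw [ENNReal.tsum_comm]
    refine tsum_congr fun i => ?_
    by_cases hyi : y ∈ Φ '' B i
    · obtain ⟨x, hx, rfl⟩ := hyi
      rw [tsum_eq_single x, hGin i x hx,
        Set.indicator_of_mem (show x ∈ Φ ⁻¹' {Φ x} ∩ B i from ⟨rfl, hx⟩)]
      intro x' hx'
      exact Set.indicator_of_notMem (fun h => hx' (hBi i h.2 hx h.1)) _
    · rw [hGout i y hyi]
      exact ENNReal.tsum_eq_zero.2 fun x => Set.indicator_of_notMem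
        (fun h => hyi ⟨x, h.2, h.1⟩) _
  refine ⟨(Measurable.tsum hGm).aemeasurable.congr hsum.symm, ?_⟩
  rw [lintegral_congr_ae hsum, lintegral_tsum fun i => (hGm i).aemeasurable]
  have hpiece : ∀ i, ∫⁻ y, G i y ∂μ
      = ∫⁻ x in B i, ENNReal.ofReal |(fderiv ℝ Φ x).det| * F x ∂μ := by
    intro i
    rw [← setLIntegral_eq_of_support_subset (s := Φ '' B i)
      (by intro y hy; by_contra h; exact hy (hGout i y h)),
      lintegral_image_eq_lintegral_abs_det_fderiv_mul μ (hBm i)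
        (fun x _ => (hd x).hasFDerivWithinAt) (hBi i)]
    exact setLIntegral_congr_fun (hBm i) fun x hx => by simp only [hGin i x hx]
  simp_rw [hpiece]
  rw [← lintegral_iUnion hBm hBd, hBu]
  refine setLIntegral_eq_of_support_subset fun x hx => ?_
  intro h0
  exact hx (by simp [h0])

/-- Area formula along the fibres of `(z, u) ↦ (g (z, u), u)` for holomorphic `g`. -/
theorem fiber_area_formula {V : Type*} [NormedAddCommGroup V] [NormedSpace ℂ V]
    [FiniteDimensional ℂ V] [MeasurableSpace V] [BorelSpace V] (ν : Measure V)
    [ν.IsAddHaarMeasure] {g : ℂ × V → ℂ} (hg : ContDiff ℂ 1 g) {F : ℂ × V → ℝ≥0∞}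
    (hF : Measurable F) :
    AEMeasurable (fun y : ℂ × V => ∑' z : {z | g (z, y.2) = y.1}, F (z, y.2))
        ((volume : Measure ℂ).prod ν) ∧
      ∫⁻ y, ∑' z : {z | g (z, y.2) = y.1}, F (z, y.2) ∂((volume : Measure ℂ).prod ν)
        = ∫⁻ x, ENNReal.ofReal (‖fderiv ℂ g x (1, 0)‖ ^ 2) * F x
            ∂((volume : Measure ℂ).prod ν) := by
  have : FiniteDimensional ℝ V := FiniteDimensional.complexToReal V
  have : ProperSpace V := FiniteDimensional.proper ℝ V
  let Φ : ℂ × V → ℂ × V := fun x => (g x, x.2)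
  have hΦ : ContDiff ℂ 1 Φ := hg.prodMk contDiff_snd
  have hfib : ∀ y : ℂ × V, ∑' x : Φ ⁻¹' {y}, F x
      = ∑' z : {z | g (z, y.2) = y.1}, F (z, y.2) := by
    intro y
    let e : {z | g (z, y.2) = y.1} ≃ Φ ⁻¹' {y} :=
      { toFun := fun z => ⟨(z, y.2), by
          have := z.2
          simp only [Set.mem_ofPred_eq] at this
          simp [Φ, this]⟩
        invFun := fun x => ⟨x.1.1, by
          have := x.2
          simp only [Φ, Set.mem_preimage, Set.mem_singleton_iff, Prod.ext_iff] at this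
          simp only [Set.mem_ofPred_eq, ← this.2, ← this.1]⟩
        left_inv := fun z => rfl
        right_inv := fun x => by
          have := x.2
          simp only [Φ, Set.mem_preimage, Set.mem_singleton_iff, Prod.ext_iff] at this
          ext <;> simp [this.2] }
    exact (e.tsum_eq (fun x : Φ ⁻¹' {y} => F x)).symm
  have hdet : ∀ x, |(fderiv ℝ Φ x).det| = ‖fderiv ℂ g x (1, 0)‖ ^ 2 := by
    intro x
    have hgx : HasFDerivAt g (fderiv ℂ g x) x := (hg.differentiable (by simp) x).hasFDerivAt
    have h1 : HasFDerivAt Φ ((fderiv ℂ g x).prod (ContinuousLinearMap.snd ℂ ℂ V)) x :=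
      hgx.prodMk hasFDerivAt_snd
    rw [(h1.restrictScalars ℝ).fderiv]
    set A := (fderiv ℂ g x).prod (ContinuousLinearMap.snd ℂ ℂ V) with hA
    -- The derivative differs from the identity by a rank-one map into the first axis, so its
    -- complex determinant is ∂g/∂z; the real determinant is the norm of that, |∂g/∂z|².
    have h2 : (A : ℂ × V →ₗ[ℂ] ℂ × V) = LinearMap.transvection
        ((fderiv ℂ g x : ℂ × V →ₗ[ℂ] ℂ) - LinearMap.fst ℂ ℂ V) ((1 : ℂ), (0 : V)) := by
      apply LinearMap.ext
      intro w
      ext <;> simp [hA, LinearMap.transvection.apply]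
    have h3 : ((A.restrictScalars ℝ).det : ℝ) = Algebra.norm ℝ (LinearMap.det
        (A : ℂ × V →ₗ[ℂ] ℂ × V)) := by
      rw [← LinearMap.det_restrictScalars]; rfl
    rw [h3, h2, LinearMap.transvection.det, Algebra.norm_complex_apply, Complex.normSq_eq_norm_sq]
    simp
  have := area_formula ((volume : Measure ℂ).prod ν) (hΦ.restrict_scalars ℝ) hF
  simpa only [hfib, hdet] using this

/-! ### Moments and characteristic function of the complex Gaussian; laws of linear combinations. -/

/-- The density `π⁻¹ exp(-|z|²)` of the standard complex Gaussian law. -/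
def gaussDensity (z : ℂ) : ℝ := Real.pi⁻¹ * Real.exp (-‖z‖ ^ 2)

theorem gaussDensity_nonneg (z : ℂ) : 0 ≤ gaussDensity z := by
  unfold gaussDensity; positivity

theorem gaussDensity_le (z : ℂ) : gaussDensity z ≤ 1 := by
  unfold gaussDensity
  have h1 : Real.pi⁻¹ ≤ 1 := inv_le_one_of_one_le₀ (by linarith [Real.pi_gt_three])
  have h2 : Real.exp (-‖z‖ ^ 2) ≤ 1 := Real.exp_le_one_iff.2 (by simp)
  exact mul_le_one₀ h1 (Real.exp_nonneg _) h2

@[fun_prop]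
theorem continuous_gaussDensity : Continuous gaussDensity := by
  unfold gaussDensity; fun_prop

theorem stdComplexGaussian_eq :
    stdComplexGaussian = (volume : Measure ℂ).withDensity
      (fun z => ENNReal.ofReal (gaussDensity z)) := rfl

theorem measurable_ofReal_gaussDensity :
    Measurable fun z => ENNReal.ofReal (gaussDensity z) := by fun_prop

theorem integral_stdComplexGaussian {F : Type*} [NormedAddCommGroup F] [NormedSpace ℝ F]
    (f : ℂ → F) : ∫ z, f z ∂stdComplexGaussian = ∫ z, gaussDensity z • f z := by
  rw [stdComplexGaussian_eq, integral_withDensity_eq_integral_toReal_smul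
    measurable_ofReal_gaussDensity (by simp)]
  simp [ENNReal.toReal_ofReal (gaussDensity_nonneg _)]

theorem lintegral_stdComplexGaussian {f : ℂ → ℝ≥0∞} (hf : Measurable f) :
    ∫⁻ z, f z ∂stdComplexGaussian = ∫⁻ z, ENNReal.ofReal (gaussDensity z) * f z := by
  rw [stdComplexGaussian_eq, lintegral_withDensity_eq_lintegral_mul _
    measurable_ofReal_gaussDensity hf]
  rfl

theorem integral_norm_rpow_mul_gaussDensity {q : ℝ} (hq : -2 < q) :
    ∫ z : ℂ, gaussDensity z * ‖z‖ ^ q = Real.Gamma ((q + 2) / 2) := by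
  have h := Complex.integral_rpow_mul_exp_neg_rpow (p := 2) (q := q) (by norm_num) hq
  have h2 : ∀ z : ℂ, gaussDensity z * ‖z‖ ^ q
      = Real.pi⁻¹ * (‖z‖ ^ q * Real.exp (-‖z‖ ^ (2 : ℝ))) := by
    intro z
    rw [gaussDensity, Real.rpow_two]; ring
  simp_rw [h2]
  rw [integral_const_mul, h]
  field_simp

theorem integral_gaussDensity : ∫ z : ℂ, gaussDensity z = 1 := by
  simpa using integral_norm_rpow_mul_gaussDensity (q := 0) (by norm_num)

theorem integral_gaussDensity_mul_norm_sq : ∫ z : ℂ, gaussDensity z * ‖z‖ ^ 2 = 1 := by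
  have h := integral_norm_rpow_mul_gaussDensity (q := 2) (by norm_num)
  simp only [Real.rpow_two] at h
  rw [h]
  norm_num [Real.Gamma_two]

theorem integrable_gaussDensity : Integrable gaussDensity := by
  -- A non-integrable function has integral 0 by convention, so the known value 1 already forces
  -- integrability.
  by_contra h
  have := integral_gaussDensity
  rw [integral_undef h] at this
  exact zero_ne_one this

instance : IsProbabilityMeasure stdComplexGaussian := by
  constructor
  rw [stdComplexGaussian_eq, withDensity_apply _ MeasurableSet.univ, setLIntegral_univ,
    ← ofReal_integral_eq_lintegral_ofReal integrable_gaussDensity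
      (ae_of_all _ gaussDensity_nonneg), integral_gaussDensity, ENNReal.ofReal_one]

theorem memLp_two_stdComplexGaussian : MemLp (fun z : ℂ => z) 2 stdComplexGaussian := by
  rw [memLp_two_iff_integrable_sq_norm (by fun_prop)]
  by_contra h
  have h1 := integral_stdComplexGaussian fun z => ‖z‖ ^ 2
  rw [integral_undef h] at h1
  simp only [smul_eq_mul, integral_gaussDensity_mul_norm_sq] at h1
  exact zero_ne_one h1

theorem integrable_id_stdComplexGaussian : Integrable (fun z : ℂ => z) stdComplexGaussian :=
  memLp_two_stdComplexGaussian.integrable (by norm_num)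

theorem integrable_norm_sq_stdComplexGaussian :
    Integrable (fun z : ℂ => ‖z‖ ^ 2) stdComplexGaussian :=
  (memLp_two_iff_integrable_sq_norm (by fun_prop)).1 memLp_two_stdComplexGaussian

theorem integral_id_stdComplexGaussian : ∫ z, z ∂stdComplexGaussian = 0 := by
  rw [integral_stdComplexGaussian]
  have h := integral_neg_eq_self (fun z : ℂ => gaussDensity z • z) volume
  simp only [gaussDensity, norm_neg, smul_neg, integral_neg] at h ⊢
  exact self_eq_neg.1 h.symm

theorem integral_norm_sq_stdComplexGaussian : ∫ z, ‖z‖ ^ 2 ∂stdComplexGaussian = 1 := by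
  rw [integral_stdComplexGaussian]
  exact integral_gaussDensity_mul_norm_sq

theorem integrable_re_mul_stdComplexGaussian (c : ℂ) :
    Integrable (fun z : ℂ => (c * z).re) stdComplexGaussian :=
  (integrable_id_stdComplexGaussian.const_mul c).re

theorem integral_re_mul_stdComplexGaussian (c : ℂ) :
    ∫ z, (c * z).re ∂stdComplexGaussian = 0 := by
  have h := integral_re (𝕜 := ℂ) (integrable_id_stdComplexGaussian.const_mul c)
  rw [integral_const_mul, integral_id_stdComplexGaussian, mul_zero] at h
  exact h

theorem norm_add_mul_sq (α β b : ℂ) :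
    ‖α + β * b‖ ^ 2 = ‖α‖ ^ 2 + 2 * (starRingEnd ℂ α * β * b).re + ‖β‖ ^ 2 * ‖b‖ ^ 2 := by
  simp only [← Complex.normSq_eq_norm_sq, Complex.normSq_apply, Complex.add_re, Complex.add_im,
    Complex.mul_re, Complex.mul_im, Complex.conj_re, Complex.conj_im]
  ring

/-- The cross term has mean zero. This integrates out the part of p'' independent of p and p'. -/
theorem lintegral_norm_sq_affine_stdComplexGaussian (α β : ℂ) :
    ∫⁻ b, ENNReal.ofReal (‖α + β * b‖ ^ 2) ∂stdComplexGaussian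
      = ENNReal.ofReal (‖α‖ ^ 2 + ‖β‖ ^ 2) := by
  simp_rw [norm_add_mul_sq]
  have h1 : Integrable (fun b : ℂ => 2 * (starRingEnd ℂ α * β * b).re) stdComplexGaussian :=
    (integrable_re_mul_stdComplexGaussian _).const_mul 2
  have h2 : Integrable (fun b : ℂ => ‖α‖ ^ 2 + 2 * (starRingEnd ℂ α * β * b).re)
    stdComplexGaussian := (integrable_const _).add h1
  have h3 : Integrable (fun b : ℂ => ‖β‖ ^ 2 * ‖b‖ ^ 2) stdComplexGaussian :=
    integrable_norm_sq_stdComplexGaussian.const_mul _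
  refine (ofReal_integral_eq_lintegral_ofReal (h2.add h3)
    (ae_of_all _ fun b => by
      simp only [Pi.add_apply, Pi.zero_apply, ← norm_add_mul_sq]; positivity)).symm.trans ?_
  congr 1
  rw [integral_add' h2 h3, integral_add (integrable_const _) h1, integral_const_mul,
    integral_const_mul, integral_re_mul_stdComplexGaussian, integral_norm_sq_stdComplexGaussian]
  simp

theorem charFunDual_stdComplexGaussian (L : StrongDual ℝ ℂ) (l : ℂ)
    (hL : ∀ w, L w = (l * w).re) :
    charFunDual stdComplexGaussian L = Complex.exp (-(‖l‖ ^ 2 : ℝ) / 4) := by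
  rw [charFunDual_apply, integral_stdComplexGaussian]
  have h := GaussianFourier.integral_cexp_neg_mul_sq_norm_add (b := 1) (V := ℂ) (by simp)
    Complex.I (starRingEnd ℂ l)
  have h2 : ∀ v : ℂ, gaussDensity v • Complex.exp (L v * Complex.I)
      = (Real.pi : ℂ)⁻¹ * Complex.exp (-1 * (‖v‖ : ℂ) ^ 2
        + Complex.I * (inner ℝ (starRingEnd ℂ l) v : ℝ)) := by
    intro v
    rw [gaussDensity, Complex.exp_add, hL]
    have : inner ℝ (starRingEnd ℂ l) v = (l * v).re := by
      rw [Complex.inner, Complex.conj_conj, mul_comm]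
    rw [this]
    simp only [Complex.real_smul]
    push_cast
    rw [mul_comm Complex.I]
    ring_nf
  simp_rw [h2]
  rw [integral_const_mul, h]
  have hpi : (Real.pi : ℂ) ≠ 0 := by exact_mod_cast Real.pi_ne_zero
  simp only [Complex.finrank_real_complex, Nat.cast_ofNat, div_one]
  rw [div_self (by norm_num : (2 : ℂ) ≠ 0), Complex.cpow_one, ← mul_assoc, inv_mul_cancel₀ hpi,
    one_mul]
  congr 1
  rw [Complex.I_sq, RCLike.norm_conj]
  push_cast
  ring

theorem continuous_sum_smul {E : Type*} [NormedAddCommGroup E] [NormedSpace ℂ E]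
    {ι : Type*} [Fintype ι] (u : ι → E) : Continuous fun a : ι → ℂ => ∑ i, a i • u i :=
  continuous_finsetSum _ fun i _ => (continuous_apply i).smul continuous_const

/-- A real functional is the real part of a complex one, and each coordinate contributes a Gaussian
factor depending only on the modulus of that functional at `u i`; independence multiplies the
factors. -/
theorem charFunDual_map_sum_smul {E : Type*} [NormedAddCommGroup E] [NormedSpace ℂ E]
    [NormedSpace ℝ E] [IsScalarTower ℝ ℂ E]
    [MeasurableSpace E] [BorelSpace E] {ι : Type*} [Fintype ι] (u : ι → E) (L : StrongDual ℝ E) :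
    charFunDual (Measure.map (fun a : ι → ℂ => ∑ i, a i • u i)
      (Measure.pi fun _ => stdComplexGaussian)) L
      = Complex.exp (-((∑ i, ‖(L.extendRCLike : StrongDual ℂ E) (u i)‖ ^ 2 : ℝ) : ℂ) / 4) := by
  classical
  let T₀ : (ι → ℂ) →ₗ[ℝ] E :=
    { toFun := fun a => ∑ i, a i • u i
      map_add' := fun a b => by simp [add_smul, Finset.sum_add_distrib]
      map_smul' := fun r a => by simp only [Pi.smul_apply, smul_assoc, Finset.smul_sum, RingHom.id_apply] }
  let T : (ι → ℂ) →L[ℝ] E := ⟨T₀, continuous_sum_smul u⟩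
  have hT : ∀ a, T a = ∑ i, a i • u i := fun a => rfl
  have h0 : Measure.map (fun a : ι → ℂ => ∑ i, a i • u i)
      (Measure.pi fun _ => stdComplexGaussian)
      = Measure.map (⇑T) (Measure.pi fun _ => stdComplexGaussian) := rfl
  rw [h0, charFunDual_map, charFunDual_pi]
  have h1 : ∀ i, charFunDual stdComplexGaussian
      ((L ∘SL T) ∘SL ContinuousLinearMap.single ℝ (fun _ : ι => ℂ) i)
      = Complex.exp (-(‖(L.extendRCLike : StrongDual ℂ E) (u i)‖ ^ 2 : ℝ) / 4) := by
    intro i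
    refine charFunDual_stdComplexGaussian _ _ fun w => ?_
    have hTi : T (Pi.single i w) = w • u i := by
      rw [hT, Finset.sum_eq_single i]
      · simp
      · intro j _ hj
        simp [hj]
      · simp
    have hre := StrongDual.re_extendRCLike_apply (𝕜 := ℂ) L (w • u i)
    simp only [ContinuousLinearMap.comp_apply, ContinuousLinearMap.single_apply, hTi]
    rw [← hre, map_smul, smul_eq_mul, mul_comm]
    rfl
  simp_rw [h1]
  rw [← Complex.exp_sum]
  congr 1
  push_cast
  rw [← Finset.sum_div, Finset.sum_neg_distrib]

/-- The law of a linear combination `∑ aⱼ uⱼ` of independent standard complex Gaussians is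
determined by the Hermitian form `L ↦ ∑ ‖L uⱼ‖²`. -/
theorem map_sum_smul_pi_eq_of_forall_dual {E : Type*} [NormedAddCommGroup E] [NormedSpace ℂ E]
    [MeasurableSpace E] [BorelSpace E] [SecondCountableTopology E] [CompleteSpace E]
    {ι κ : Type*} [Fintype ι] [Fintype κ] (u : ι → E) (u' : κ → E)
    (h : ∀ L : StrongDual ℂ E, ∑ i, ‖L (u i)‖ ^ 2 = ∑ k, ‖L (u' k)‖ ^ 2) :
    Measure.map (fun a : ι → ℂ => ∑ i, a i • u i) (Measure.pi fun _ => stdComplexGaussian)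
      = Measure.map (fun a : κ → ℂ => ∑ k, a k • u' k)
        (Measure.pi fun _ => stdComplexGaussian) := by
  have : IsProbabilityMeasure (Measure.map (fun a : ι → ℂ => ∑ i, a i • u i)
      (Measure.pi fun _ => stdComplexGaussian)) :=
    Measure.isProbabilityMeasure_map (continuous_sum_smul u).measurable.aemeasurable
  have : IsProbabilityMeasure (Measure.map (fun a : κ → ℂ => ∑ i, a i • u' i)
      (Measure.pi fun _ => stdComplexGaussian)) :=
    Measure.isProbabilityMeasure_map (continuous_sum_smul u').measurable.aemeasurable
  refine Measure.ext_of_charFunDual (funext fun L => ?_)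
  rw [charFunDual_map_sum_smul, charFunDual_map_sum_smul, h]

/-- Splitting the first two coordinates off a standard complex Gaussian vector. -/
theorem measurePreserving_splitTwo (m : ℕ) :
    MeasurePreserving (fun a : Fin (m + 2) → ℂ => (a 0, a 1, fun i : Fin m => a i.succ.succ))
      (Measure.pi fun _ => stdComplexGaussian)
      (stdComplexGaussian.prod (stdComplexGaussian.prod
        (Measure.pi fun _ => stdComplexGaussian))) := by
  have h1 := measurePreserving_piFinSuccAbove (n := m + 1) (fun _ => stdComplexGaussian) 0
  have h2 := measurePreserving_piFinSuccAbove (n := m) (fun _ => stdComplexGaussian) 0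
  exact ((MeasurePreserving.id stdComplexGaussian).prod h2).comp h1

theorem pi_stdComplexGaussian_absolutelyContinuous (m : ℕ) :
    Measure.pi (fun _ : Fin m => stdComplexGaussian) ≪ (volume : Measure (Fin m → ℂ)) := by
  induction m with
  | zero =>
    rw [volume_pi, Measure.pi_of_empty, Measure.pi_of_empty]
  | succ m ih =>
    have h1 := measurePreserving_piFinSuccAbove (n := m) (fun _ => stdComplexGaussian) 0
    have h2 := measurePreserving_piFinSuccAbove (n := m) (fun _ => (volume : Measure ℂ)) 0
    have hγ : stdComplexGaussian ≪ volume := withDensity_absolutelyContinuous _ _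
    have h3 := (hγ.prod ih).map
      (MeasurableEquiv.piFinSuccAbove (fun _ : Fin (m + 1) => ℂ) 0).symm.measurable
    have h4 := (h1.symm (MeasurableEquiv.piFinSuccAbove (fun _ : Fin (m + 1) => ℂ) 0)).map_eq
    have h5 := (h2.symm (MeasurableEquiv.piFinSuccAbove (fun _ : Fin (m + 1) => ℂ) 0)).map_eq
    rw [h4] at h3
    rw [volume_pi, ← h5]
    exact h3

/-! ### Binomial moments and the Hermitian form of the jet (p, p'/√n, p''). -/

/-- The absorption identity j·C(n, j) = n·C(n-1, j-1). Passing from g(j) to j·g(j-1) can be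
iterated, so all factorial moments follow from the binomial theorem. -/
theorem sum_choose_mul_pow_mul_descend {r : ℝ} (hr : 0 ≤ r) {g : ℝ → ℝ} {k : ℕ}
    (hg : ∀ n : ℕ, ∑ j ∈ Finset.range (n + 1), (n.choose j : ℝ) * r ^ j * g j
      = g n * (r / (1 + r)) ^ k * (1 + r) ^ n) (n : ℕ) :
    ∑ j ∈ Finset.range (n + 1), (n.choose j : ℝ) * r ^ j * (j * g (j - 1))
      = (n * g (n - 1)) * (r / (1 + r)) ^ (k + 1) * (1 + r) ^ n := by
  have hR : (1 + r) ≠ 0 := by positivity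
  cases n with
  | zero => simp
  | succ n =>
    rw [Finset.sum_range_succ']
    have h1 : ∀ j : ℕ, ((n + 1).choose (j + 1) : ℝ) * r ^ (j + 1)
        * (((j + 1 : ℕ) : ℝ) * g (((j + 1 : ℕ) : ℝ) - 1))
        = (n + 1) * r * ((n.choose j : ℝ) * r ^ j * g j) := by
      intro j
      have h2 : ((n + 1 : ℕ) : ℝ) * n.choose j = (n + 1).choose (j + 1) * ((j + 1 : ℕ) : ℝ) := by
        exact_mod_cast Nat.add_one_mul_choose_eq n j
      have h3 : (((j + 1 : ℕ) : ℝ) - 1) = j := by push_cast; ring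
      rw [h3]
      push_cast at h2 ⊢
      linear_combination (-(r ^ (j + 1) * g j)) * h2
    simp_rw [h1]
    rw [← Finset.mul_sum, hg n]
    push_cast
    rw [add_sub_cancel_right]
    have h5 : r = r / (1 + r) * (1 + r) := by field_simp
    rw [pow_succ (r / (1 + r)), pow_succ (1 + r)]
    linear_combination ((n : ℝ) + 1) * g n * (r / (1 + r)) ^ k * (1 + r) ^ n * h5

/-- Up to the total mass (1 + r)^n, this is the second moment of a quadratic polynomial under the
binomial law with parameter r/(1 + r). The three squares are its components along the orthogonal
(Krawtchouk) polynomials of degrees 0, 1 and 2; only factorial moments up to order four enter. -/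
theorem sum_choose_mul_pow_mul_sq {r : ℝ} (hr : 0 ≤ r) (n : ℕ) (A B C : ℝ) :
    ∑ j ∈ Finset.range (n + 1),
        (n.choose j : ℝ) * r ^ j * (A + B * j + C * (j * (j - 1))) ^ 2
      = (1 + r) ^ n * ((A + B * (n * (r / (1 + r))) + C * (n * (n - 1) * (r / (1 + r)) ^ 2)) ^ 2
        + n * r / (1 + r) ^ 2 * (B + 2 * (n - 1) * (r / (1 + r)) * C) ^ 2
        + 2 * n * (n - 1) * r ^ 2 / (1 + r) ^ 4 * C ^ 2) := by
  have hR : (1 + r) ≠ 0 := by positivity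
  have h0 : ∀ n : ℕ, ∑ j ∈ Finset.range (n + 1), (n.choose j : ℝ) * r ^ j * (fun _ => (1 : ℝ)) (j : ℝ)
      = (fun _ => (1 : ℝ)) (n : ℝ) * (r / (1 + r)) ^ 0 * (1 + r) ^ n := by
    intro n
    simp only [pow_zero, mul_one, one_mul]
    rw [add_comm 1 r, add_pow]
    exact Finset.sum_congr rfl fun j _ => by ring
  have h1 := sum_choose_mul_pow_mul_descend hr (g := fun _ => (1 : ℝ)) h0
  have h2 := sum_choose_mul_pow_mul_descend hr (g := fun x => x * 1) h1
  have h3 := sum_choose_mul_pow_mul_descend hr (g := fun x => x * ((x - 1) * 1)) h2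
  have h4 := sum_choose_mul_pow_mul_descend hr
    (g := fun x => x * ((x - 1) * ((x - 1 - 1) * 1))) h3
  have e : ∀ j : ℕ, (n.choose j : ℝ) * r ^ j * (A + B * j + C * (j * (j - 1))) ^ 2
      = A ^ 2 * ((n.choose j : ℝ) * r ^ j * 1)
        + (2 * A * B + B ^ 2) * ((n.choose j : ℝ) * r ^ j * (j * 1))
        + (B ^ 2 + 2 * A * C + 4 * B * C + 2 * C ^ 2)
          * ((n.choose j : ℝ) * r ^ j * (j * ((j - 1) * 1)))
        + (2 * B * C + 4 * C ^ 2)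
          * ((n.choose j : ℝ) * r ^ j * (j * ((j - 1) * ((j - 1 - 1) * 1))))
        + C ^ 2 * ((n.choose j : ℝ) * r ^ j
          * (j * ((j - 1) * ((j - 1 - 1) * ((j - 1 - 1 - 1) * 1))))) := by
    intro j; ring
  simp_rw [e]
  simp only [Finset.sum_add_distrib, ← Finset.mul_sum]
  rw [h0 n, h1 n, h2 n, h3 n, h4 n]
  have ht1 : n * r / (1 + r) ^ 2 = n * (r / (1 + r) * (1 - r / (1 + r))) := by
    field_simp; ring
  have ht2 : 2 * n * (n - 1) * r ^ 2 / (1 + r) ^ 4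
      = 2 * n * (n - 1) * (r / (1 + r) * (1 - r / (1 + r))) ^ 2 := by
    field_simp; ring
  rw [ht1, ht2]
  generalize r / (1 + r) = t
  ring

theorem sum_choose_mul_pow_mul_norm_sq {r : ℝ} (hr : 0 ≤ r) (n : ℕ) (A B C : ℂ) :
    ∑ j ∈ Finset.range (n + 1),
        (n.choose j : ℝ) * r ^ j * ‖A + B * (j : ℝ) + C * ((j * (j - 1) : ℝ) : ℂ)‖ ^ 2
      = (1 + r) ^ n * (‖A + B * ((n * (r / (1 + r)) : ℝ) : ℂ)
          + C * ((n * (n - 1) * (r / (1 + r)) ^ 2 : ℝ) : ℂ)‖ ^ 2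
        + n * r / (1 + r) ^ 2 * ‖B + ((2 * (n - 1) * (r / (1 + r)) : ℝ) : ℂ) * C‖ ^ 2
        + 2 * n * (n - 1) * r ^ 2 / (1 + r) ^ 4 * ‖C‖ ^ 2) := by
  simp only [← Complex.normSq_eq_norm_sq, Complex.normSq_apply, Complex.add_re, Complex.add_im,
    Complex.re_mul_ofReal, Complex.im_mul_ofReal, Complex.re_ofReal_mul, Complex.im_ofReal_mul]
  have h1 := sum_choose_mul_pow_mul_sq hr n A.re B.re C.re
  have h2 := sum_choose_mul_pow_mul_sq hr n A.im B.im C.im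
  have h3 := congrArg₂ (· + ·) h1 h2
  simp only [← Finset.sum_add_distrib] at h3
  refine (Finset.sum_congr rfl fun j _ => by ring).trans (h3.trans (by ring))

/-- `√(n choose j) z^j` for `n = m + 1`, `j = i + 2`. -/
def tailCoeff (m : ℕ) (i : Fin m) (z : ℂ) : ℂ :=
  (Real.sqrt ((m + 1).choose (i + 2) : ℝ) : ℂ) * z ^ (i + 2 : ℕ)

/-- The derivative of `tailCoeff`. -/
def tailCoeffDeriv (m : ℕ) (i : Fin m) (z : ℂ) : ℂ :=
  (Real.sqrt ((m + 1).choose (i + 2) : ℝ) : ℂ) * ((i + 2 : ℕ) * z ^ (i + 1 : ℕ))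

/-- The second derivative of `tailCoeff`. -/
def tailCoeffDeriv2 (m : ℕ) (i : Fin m) (z : ℂ) : ℂ :=
  (Real.sqrt ((m + 1).choose (i + 2) : ℝ) : ℂ) * ((i + 2 : ℕ) * ((i + 1 : ℕ) * z ^ (i : ℕ)))

/-- `√n` for `n = m + 1`, as a complex number. -/
def sqrtDeg (m : ℕ) : ℂ := (Real.sqrt (m + 1 : ℝ) : ℂ)

theorem sqrtDeg_sq (m : ℕ) : sqrtDeg m ^ 2 = m + 1 := by
  rw [sqrtDeg, ← Complex.ofReal_pow, Real.sq_sqrt (by positivity)]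
  push_cast; ring

theorem sqrtDeg_ne_zero (m : ℕ) : sqrtDeg m ≠ 0 := by
  rw [sqrtDeg]
  exact_mod_cast (Real.sqrt_pos.2 (by positivity)).ne'

theorem norm_sqrtDeg_sq (m : ℕ) : ‖sqrtDeg m‖ ^ 2 = m + 1 := by
  rw [← norm_pow, sqrtDeg_sq]
  norm_cast

/-- The coefficient vectors of `(p(z), p'(z)/√n, p''(z))` in terms of the random coefficients. -/
def jetVec (m : ℕ) (z : ℂ) : Fin (m + 2) → ℂ × ℂ × ℂ :=
  Fin.cons (1, 0, 0) (Fin.cons (sqrtDeg m * z, 1, 0)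
    fun i => (tailCoeff m i z, tailCoeffDeriv m i z / sqrtDeg m, tailCoeffDeriv2 m i z))

/-- The factor `√((1 + |z|²)^n)`, `n = m + 1`. -/
def rootKernel (m : ℕ) (z : ℂ) : ℂ := (Real.sqrt ((1 + ‖z‖ ^ 2) ^ (m + 1)) : ℂ)

/-- A triangular system of vectors with the same Hermitian form as `jetVec`. -/
def jetVecTriangular (m : ℕ) (z : ℂ) : Fin (1 + 2) → ℂ × ℂ × ℂ :=
  Fin.cons (rootKernel m z, rootKernel m z / (1 + ‖z‖ ^ 2 : ℝ) * (sqrtDeg m * starRingEnd ℂ z),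
      rootKernel m z / ((1 + ‖z‖ ^ 2) ^ 2 : ℝ) * ((m + 1) * m * starRingEnd ℂ z ^ 2))
    (Fin.cons (0, rootKernel m z / (1 + ‖z‖ ^ 2 : ℝ),
      rootKernel m z / ((1 + ‖z‖ ^ 2) ^ 2 : ℝ) * (2 * sqrtDeg m * m * starRingEnd ℂ z))
    fun _ => (0, 0, rootKernel m z / ((1 + ‖z‖ ^ 2) ^ 2 : ℝ)
      * (Real.sqrt (2 * (m + 1) * m) : ℂ)))

theorem norm_rootKernel_sq (m : ℕ) (z : ℂ) :
    ‖rootKernel m z‖ ^ 2 = (1 + ‖z‖ ^ 2) ^ (m + 1) := by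
  rw [rootKernel, Complex.norm_real, Real.norm_eq_abs, sq_abs, Real.sq_sqrt (by positivity)]

theorem sum_norm_sq_dual_jetVec (m : ℕ) {z : ℂ} (hz : z ≠ 0) (L : StrongDual ℂ (ℂ × ℂ × ℂ)) :
    ∑ j, ‖L (jetVec m z j)‖ ^ 2 = ∑ j, ‖L (jetVecTriangular m z j)‖ ^ 2 := by
  obtain ⟨l0, l1, l2, hL⟩ : ∃ l0 l1 l2 : ℂ, ∀ x y w : ℂ, L (x, y, w) = l0 * x + l1 * y + l2 * w := by
    refine ⟨L (1, 0, 0), L (0, 1, 0), L (0, 0, 1), fun x y w => ?_⟩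
    have : ((x, y, w) : ℂ × ℂ × ℂ) = x • (1, 0, 0) + y • (0, 1, 0) + w • (0, 0, 1) := by simp
    rw [this, map_add, map_add, map_smul, map_smul, map_smul]
    simp only [smul_eq_mul]
    ring
  have hs := sqrtDeg_ne_zero m
  have hs2 := sqrtDeg_sq m
  set s := sqrtDeg m with hsdef
  set r : ℝ := ‖z‖ ^ 2 with hr
  have hr0 : 0 ≤ r := by positivity
  have hrz : (r : ℂ) = z * starRingEnd ℂ z := by
    rw [Complex.mul_conj, Complex.normSq_eq_norm_sq]
  -- Dividing by powers of z makes `L` of the j-th coefficient vector equal to √C(n, j)·z^j times a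
  -- quadratic polynomial in j, as the binomial identity requires. Here z ≠ 0 is needed.
  set A : ℂ := l0 with hA
  set B : ℂ := l1 / (s * z) with hB
  set D : ℂ := l2 / z ^ 2 with hD
  have hleft : ∀ j : Fin (m + 2), ‖L (jetVec m z j)‖ ^ 2
      = ((m + 1).choose j : ℝ) * r ^ (j : ℕ)
        * ‖A + B * ((j : ℕ) : ℝ) + D * ((((j : ℕ) : ℝ) * (((j : ℕ) : ℝ) - 1) : ℝ) : ℂ)‖ ^ 2 := by
    have hgen : ∀ (j : ℕ) (w : ℂ), w = (Real.sqrt ((m + 1).choose j : ℝ) : ℂ) * z ^ j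
          * (A + B * (j : ℝ) + D * (((j : ℝ) * ((j : ℝ) - 1) : ℝ) : ℂ)) →
        ‖w‖ ^ 2 = ((m + 1).choose j : ℝ) * r ^ j
          * ‖A + B * (j : ℝ) + D * (((j : ℝ) * ((j : ℝ) - 1) : ℝ) : ℂ)‖ ^ 2 := by
      intro j w hw
      rw [hw, norm_mul, norm_mul, mul_pow, mul_pow, Complex.norm_real, Real.norm_eq_abs, sq_abs,
        Real.sq_sqrt (by positivity), norm_pow, hr]
      ring
    intro j
    apply hgen
    refine Fin.cases ?_ (fun j => Fin.cases ?_ (fun i => ?_) j) j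
    · simp [jetVec, hL]
    · simp only [jetVec, Fin.cons_succ, Fin.cons_zero, hL, Fin.val_succ, Fin.val_zero, zero_add,
        Nat.choose_one_right]
      rw [← hsdef]
      have : (Real.sqrt ((m + 1 : ℕ) : ℝ) : ℂ) = s := by rw [hsdef, sqrtDeg]; push_cast; rfl
      rw [this, hB]
      push_cast
      field_simp
      ring
    · simp only [jetVec, Fin.cons_succ, hL, Fin.val_succ, tailCoeff, tailCoeffDeriv,
        tailCoeffDeriv2, hB, hD]
      rw [← hsdef]
      push_cast
      field_simp
      ring
  have hright : ∑ j, ‖L (jetVecTriangular m z j)‖ ^ 2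
      = (1 + r) ^ (m + 1) * (‖A + B * (((m + 1 : ℕ) * (r / (1 + r)) : ℝ) : ℂ)
          + D * (((m + 1 : ℕ) * ((m + 1 : ℕ) - 1) * (r / (1 + r)) ^ 2 : ℝ) : ℂ)‖ ^ 2
        + (m + 1 : ℕ) * r / (1 + r) ^ 2
          * ‖B + ((2 * ((m + 1 : ℕ) - 1) * (r / (1 + r)) : ℝ) : ℂ) * D‖ ^ 2
        + 2 * (m + 1 : ℕ) * ((m + 1 : ℕ) - 1) * r ^ 2 / (1 + r) ^ 4 * ‖D‖ ^ 2) := by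
    have hR : ((1 + r : ℝ) : ℂ) ≠ 0 := by
      exact_mod_cast (by positivity : (1 + r) ≠ 0)
    have hRpos : 0 < 1 + r := by positivity
    push_cast at hR
    rw [hrz] at hR
    -- Eliminating m in favour of s = √n leaves rational identities in s, z and the conjugate of z.
    have hm : (m : ℂ) = s ^ 2 - 1 := by rw [hs2]; ring
    have hζ := norm_rootKernel_sq m z
    rw [← hr] at hζ
    have e0 : L (jetVecTriangular m z 0) = rootKernel m z
        * (A + B * (((m + 1 : ℕ) * (r / (1 + r)) : ℝ) : ℂ)
          + D * (((m + 1 : ℕ) * ((m + 1 : ℕ) - 1) * (r / (1 + r)) ^ 2 : ℝ) : ℂ)) := by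
      simp only [jetVecTriangular, Fin.cons_zero, hL, hB, hD, ← hsdef]
      rw [← hr]
      push_cast
      rw [hrz, hm]
      field_simp
      ring
    have e1 : L (jetVecTriangular m z 1) = rootKernel m z / ((1 + r : ℝ) : ℂ) * (s * z)
        * (B + ((2 * ((m + 1 : ℕ) - 1) * (r / (1 + r)) : ℝ) : ℂ) * D) := by
      change L (0, _, _) = _
      simp only [hL, hB, hD, ← hsdef]
      rw [← hr]
      push_cast
      rw [hrz, hm]
      field_simp
      ring
    have e2 : L (jetVecTriangular m z 2) = rootKernel m z / (((1 + r) ^ 2 : ℝ) : ℂ)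
        * (Real.sqrt (2 * (m + 1) * m) : ℂ) * z ^ 2 * D := by
      change L (0, 0, _) = _
      simp only [hL, hD]
      rw [← hr]
      field_simp
      ring
    rw [Fin.sum_univ_three, e0, e1, e2]
    simp only [norm_mul, norm_div, norm_pow, mul_pow, div_pow, hζ, Complex.norm_real,
      Real.norm_eq_abs, sq_abs, ← hr]
    rw [Real.sq_sqrt (by positivity), hsdef, norm_sqrtDeg_sq]
    push_cast
    field_simp
    ring
  rw [hright, ← sum_choose_mul_pow_mul_norm_sq hr0, ← Fin.sum_univ_eq_sum_range
    (fun j => ((m + 1).choose j : ℝ) * r ^ j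
        * ‖A + B * (j : ℝ) + D * (((j : ℝ) * ((j : ℝ) - 1) : ℝ) : ℂ)‖ ^ 2)]
  exact Finset.sum_congr rfl fun j _ => hleft j

/-! ### The weighted density of (p, p'/√n), computed in two ways. -/

theorem lintegral_comp_affine {c : ℂ} (hc : c ≠ 0) (d : ℂ) (f : ℂ → ℝ≥0∞) :
    ∫⁻ b, f (c * b + d) = ENNReal.ofReal ((‖c‖ ^ 2)⁻¹) * ∫⁻ y, f y := by
  have hder : ∀ x ∈ Set.univ, HasFDerivWithinAt (fun b : ℂ => c * b + d)
      ((c • ContinuousLinearMap.id ℂ ℂ).restrictScalars ℝ) Set.univ x := by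
    intro x _
    have h : HasFDerivAt (fun b : ℂ => c * b + d) (c • ContinuousLinearMap.id ℂ ℂ) x :=
      ((hasFDerivAt_id x).const_mul c).add_const d
    exact (h.restrictScalars ℝ).hasFDerivWithinAt
  have hinj : Set.InjOn (fun b : ℂ => c * b + d) Set.univ := by
    intro x _ y _ h
    simpa [hc] using h
  have himg : (fun b : ℂ => c * b + d) '' Set.univ = Set.univ := by
    rw [Set.image_univ, Set.range_eq_univ]
    intro y
    exact ⟨(y - d) / c, by field_simp; ring⟩
  have h := lintegral_image_eq_lintegral_abs_det_fderiv_mul volume MeasurableSet.univ hder hinj f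
  have hdet : ((c • ContinuousLinearMap.id ℂ ℂ).restrictScalars ℝ).det = ‖c‖ ^ 2 := by
    have h3 : ((c • ContinuousLinearMap.id ℂ ℂ).restrictScalars ℝ).det
        = Algebra.norm ℝ (LinearMap.det (c • LinearMap.id : ℂ →ₗ[ℂ] ℂ)) := by
      rw [← LinearMap.det_restrictScalars]; rfl
    rw [h3, LinearMap.det_smul, LinearMap.det_id, Algebra.norm_complex_apply,
      Complex.normSq_eq_norm_sq]
    simp
  rw [himg, setLIntegral_univ, setLIntegral_univ, hdet] at h
  rw [h, abs_of_nonneg (by positivity)]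
  rw [lintegral_const_mul' _ _ ENNReal.ofReal_ne_top, ← mul_assoc,
    ← ENNReal.ofReal_mul (by positivity), inv_mul_cancel₀ (by positivity), ENNReal.ofReal_one,
    one_mul]

/-- The terms of degree at least two of the random polynomial. -/
def tailEval (m : ℕ) (v : Fin m → ℂ) (z : ℂ) : ℂ := ∑ i, v i * tailCoeff m i z

/-- The derivative of `tailEval`. -/
def tailEvalDeriv (m : ℕ) (v : Fin m → ℂ) (z : ℂ) : ℂ := ∑ i, v i * tailCoeffDeriv m i z

/-- The second derivative of `tailEval`. -/
def tailEvalDeriv2 (m : ℕ) (v : Fin m → ℂ) (z : ℂ) : ℂ := ∑ i, v i * tailCoeffDeriv2 m i z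

@[fun_prop]
theorem continuous_tailEval (m : ℕ) :
    Continuous fun x : (Fin m → ℂ) × ℂ => tailEval m x.1 x.2 := by
  unfold tailEval tailCoeff; fun_prop

@[fun_prop]
theorem continuous_tailEvalDeriv (m : ℕ) :
    Continuous fun x : (Fin m → ℂ) × ℂ => tailEvalDeriv m x.1 x.2 := by
  unfold tailEvalDeriv tailCoeffDeriv; fun_prop

@[fun_prop]
theorem continuous_tailEvalDeriv2 (m : ℕ) :
    Continuous fun x : (Fin m → ℂ) × ℂ => tailEvalDeriv2 m x.1 x.2 := by
  unfold tailEvalDeriv2 tailCoeffDeriv2; fun_prop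

theorem sum_smul_jetVec (m : ℕ) (z : ℂ) (a : Fin (m + 2) → ℂ) :
    ∑ j, a j • jetVec m z j
      = (a 0 + sqrtDeg m * z * a 1 + tailEval m (fun i => a i.succ.succ) z,
          a 1 + tailEvalDeriv m (fun i => a i.succ.succ) z / sqrtDeg m,
          tailEvalDeriv2 m (fun i => a i.succ.succ) z) := by
  rw [Fin.sum_univ_succ, Fin.sum_univ_succ]
  simp only [jetVec, Fin.cons_zero, Fin.cons_succ, Prod.smul_mk, smul_eq_mul, mul_one, mul_zero,
    tailEval, tailEvalDeriv, tailEvalDeriv2, Finset.sum_div, Fin.succ_zero_eq_one]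
  ext
  · simp [Prod.fst_sum]; ring
  · simp [Prod.fst_sum, Prod.snd_sum, mul_div_assoc]
  · simp [Prod.snd_sum]

/-- The coefficients of `p''(z)` along the two coordinates that determine `p(z)` and `p'(z)`. -/
def jetShift (m : ℕ) (z b₀ b₁ : ℂ) : ℂ :=
  rootKernel m z / ((1 + ‖z‖ ^ 2) ^ 2 : ℝ)
    * ((m + 1) * m * starRingEnd ℂ z ^ 2 * b₀ + 2 * sqrtDeg m * m * starRingEnd ℂ z * b₁)

/-- The standard deviation of the part of `p''(z)` independent of `p(z)` and `p'(z)`. -/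
def jetSigma (m : ℕ) (z : ℂ) : ℂ :=
  rootKernel m z / ((1 + ‖z‖ ^ 2) ^ 2 : ℝ) * (Real.sqrt (2 * (m + 1) * m) : ℂ)

/-- The factor `√((1 + |z|²)^n) / (1 + |z|²)`. -/
def rootKernel' (m : ℕ) (z : ℂ) : ℂ := rootKernel m z / (1 + ‖z‖ ^ 2 : ℝ)

theorem sum_smul_jetVecTriangular (m : ℕ) (z : ℂ) (b : Fin (1 + 2) → ℂ) :
    ∑ j, b j • jetVecTriangular m z j
      = (rootKernel m z * b 0,
          rootKernel' m z * b 1 + rootKernel' m z * (sqrtDeg m * starRingEnd ℂ z) * b 0,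
          jetShift m z (b 0) (b 1) + jetSigma m z * b 2) := by
  rw [Fin.sum_univ_three]
  have h2 : jetVecTriangular m z 2 = (0, 0, rootKernel m z / ((1 + ‖z‖ ^ 2) ^ 2 : ℝ)
      * (Real.sqrt (2 * (m + 1) * m) : ℂ)) := rfl
  have h1 : jetVecTriangular m z 1 = (0, rootKernel m z / (1 + ‖z‖ ^ 2 : ℝ),
      rootKernel m z / ((1 + ‖z‖ ^ 2) ^ 2 : ℝ) * (2 * sqrtDeg m * m * starRingEnd ℂ z)) := rfl
  have h0 : jetVecTriangular m z 0 = (rootKernel m z,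
      rootKernel m z / (1 + ‖z‖ ^ 2 : ℝ) * (sqrtDeg m * starRingEnd ℂ z),
      rootKernel m z / ((1 + ‖z‖ ^ 2) ^ 2 : ℝ) * ((m + 1) * m * starRingEnd ℂ z ^ 2)) := rfl
  rw [h0, h1, h2]
  simp only [Prod.smul_mk, Prod.mk_add_mk, smul_eq_mul, jetShift, jetSigma, rootKernel']
  ext <;> simp only <;> ring

/-- The `m`-dimensional standard complex Gaussian law. -/
def gaussVec (m : ℕ) : Measure (Fin m → ℂ) := Measure.pi fun _ => stdComplexGaussian

instance (m : ℕ) : IsProbabilityMeasure (gaussVec m) := by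
  unfold gaussVec; infer_instance

/-- The joint law of `(p(z), p'(z)/√n, p''(z))`, computed in two ways. -/
theorem lintegral_jet_eq (m : ℕ) {z : ℂ} (hz : z ≠ 0) {Ψ : ℂ × ℂ × ℂ → ℝ≥0∞}
    (hΨ : Measurable Ψ) :
    ∫⁻ a₀, ∫⁻ a₁, ∫⁻ v, Ψ (a₀ + sqrtDeg m * z * a₁ + tailEval m v z,
        a₁ + tailEvalDeriv m v z / sqrtDeg m, tailEvalDeriv2 m v z)
        ∂gaussVec m ∂stdComplexGaussian ∂stdComplexGaussian
      = ∫⁻ b₀, ∫⁻ b₁, ∫⁻ b₂, Ψ (rootKernel m z * b₀,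
          rootKernel' m z * b₁ + rootKernel' m z * (sqrtDeg m * starRingEnd ℂ z) * b₀,
          jetShift m z b₀ b₁ + jetSigma m z * b₂)
          ∂stdComplexGaussian ∂stdComplexGaussian ∂stdComplexGaussian := by
  have hlaw := map_sum_smul_pi_eq_of_forall_dual (jetVec m z) (jetVecTriangular m z)
    (sum_norm_sq_dual_jetVec m hz)
  have h := congrArg (fun μ => ∫⁻ x, Ψ x ∂μ) hlaw
  rw [lintegral_map hΨ (continuous_sum_smul _).measurable,
    lintegral_map hΨ (continuous_sum_smul _).measurable] at h
  simp_rw [sum_smul_jetVec, sum_smul_jetVecTriangular] at h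
  have hm1 : Measurable fun x : ℂ × ℂ × (Fin m → ℂ) =>
      Ψ (x.1 + sqrtDeg m * z * x.2.1 + tailEval m x.2.2 z,
        x.2.1 + tailEvalDeriv m x.2.2 z / sqrtDeg m, tailEvalDeriv2 m x.2.2 z) := by
    refine hΨ.comp (Continuous.measurable ?_)
    fun_prop
  have hm2 : Measurable fun x : ℂ × ℂ × (Fin 1 → ℂ) =>
      Ψ (rootKernel m z * x.1,
          rootKernel' m z * x.2.1 + rootKernel' m z * (sqrtDeg m * starRingEnd ℂ z) * x.1,
          jetShift m z x.1 x.2.1 + jetSigma m z * x.2.2 0) := by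
    refine hΨ.comp (Continuous.measurable ?_)
    unfold jetShift
    fun_prop
  have e1 := (measurePreserving_splitTwo m).lintegral_comp hm1
  -- Indexing the triangular system by `Fin (1 + 2)` lets the same splitting apply; the remaining
  -- `Fin 1` coordinate is evaluated at the end.
  have e2 := (measurePreserving_splitTwo 1).lintegral_comp hm2
  have h' := e1.symm.trans (h.trans e2)
  rw [lintegral_prod _ hm1.aemeasurable, lintegral_prod _ hm2.aemeasurable] at h'
  have p1 : ∀ a₀ : ℂ, _ := fun a₀ : ℂ =>
    lintegral_prod (μ := stdComplexGaussian)
      (ν := Measure.pi fun _ : Fin m => stdComplexGaussian) _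
      (hm1.comp (measurable_prodMk_left (x := a₀))).aemeasurable
  have p2 : ∀ b₀ : ℂ, _ := fun b₀ : ℂ =>
    lintegral_prod (μ := stdComplexGaussian)
      (ν := Measure.pi fun _ : Fin 1 => stdComplexGaussian) _
      (hm2.comp (measurable_prodMk_left (x := b₀))).aemeasurable
  simp only [Function.comp_def] at p1 p2
  simp_rw [p1, p2] at h'
  refine h'.trans (lintegral_congr fun b₀ => lintegral_congr fun b₁ => ?_)
  have hev := measurePreserving_eval (fun _ : Fin 1 => stdComplexGaussian) 0
  refine hev.lintegral_comp (f := fun b₂ => Ψ (rootKernel m z * b₀,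
          rootKernel' m z * b₁ + rootKernel' m z * (sqrtDeg m * starRingEnd ℂ z) * b₀,
          jetShift m z b₀ b₁ + jetSigma m z * b₂)) ?_
  refine hΨ.comp (Continuous.measurable ?_)
  fun_prop

theorem lintegral_lintegral_lintegral_reverse {α β δ : Type*} [MeasurableSpace α]
    [MeasurableSpace β] [MeasurableSpace δ] (μ : Measure α) (ν : Measure β) (τ : Measure δ)
    [SFinite μ] [SFinite ν] [SFinite τ] {f : α → β → δ → ℝ≥0∞}
    (hf : Measurable fun x : α × β × δ => f x.1 x.2.1 x.2.2) :
    ∫⁻ a, ∫⁻ b, ∫⁻ c, f a b c ∂τ ∂ν ∂μ = ∫⁻ c, ∫⁻ b, ∫⁻ a, f a b c ∂μ ∂ν ∂τ := by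
  have h1 : ∀ a, ∫⁻ b, ∫⁻ c, f a b c ∂τ ∂ν = ∫⁻ c, ∫⁻ b, f a b c ∂ν ∂τ := fun a =>
    lintegral_lintegral_swap (hf.comp (measurable_prodMk_left (x := a))).aemeasurable
  have h2 : Measurable fun x : α × δ => ∫⁻ b, f x.1 b x.2 ∂ν :=
    Measurable.lintegral_prod_right' (f := fun y : (α × δ) × β => f y.1.1 y.2 y.1.2)
      (hf.comp (by fun_prop : Measurable fun y : (α × δ) × β => (y.1.1, y.2, y.1.2)))
  simp_rw [h1]
  rw [lintegral_lintegral_swap h2.aemeasurable]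
  refine lintegral_congr fun c => lintegral_lintegral_swap ?_
  exact (hf.comp (by fun_prop : Measurable fun y : α × β => (y.1, y.2, c))).aemeasurable

/-- Joint density of `(p(z), p'(z)/√n)` weighted by `|p''(z)|²`, conditionally on the coefficients
of degree at least two. -/
def jetIntegrand (m : ℕ) (z x y : ℂ) (v : Fin m → ℂ) : ℝ :=
  gaussDensity (y - tailEvalDeriv m v z / sqrtDeg m)
    * (gaussDensity (x - (sqrtDeg m * z * (y - tailEvalDeriv m v z / sqrtDeg m) + tailEval m v z))
      * ‖tailEvalDeriv2 m v z‖ ^ 2)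

theorem jetIntegrand_nonneg (m : ℕ) (z x y : ℂ) (v : Fin m → ℂ) : 0 ≤ jetIntegrand m z x y v :=
  mul_nonneg (gaussDensity_nonneg _) (mul_nonneg (gaussDensity_nonneg _) (by positivity))

@[fun_prop]
theorem continuous_jetIntegrand (m : ℕ) :
    Continuous fun q : ℂ × ℂ × ℂ × (Fin m → ℂ) => jetIntegrand m q.1 q.2.1 q.2.2.1 q.2.2.2 := by
  unfold jetIntegrand; fun_prop

/-- With v frozen, passing from (a₁, a₀) to (y, x) is a translation in a₁ followed by one in a₀, so
no Jacobian appears. -/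
theorem lintegral_jet_left (m : ℕ) (z : ℂ) {F : ℂ × ℂ → ℝ≥0∞} (hF : Measurable F) :
    ∫⁻ a₀, ∫⁻ a₁, ∫⁻ v, F (a₀ + sqrtDeg m * z * a₁ + tailEval m v z,
        a₁ + tailEvalDeriv m v z / sqrtDeg m) * ENNReal.ofReal (‖tailEvalDeriv2 m v z‖ ^ 2)
        ∂gaussVec m ∂stdComplexGaussian ∂stdComplexGaussian
      = ∫⁻ x, ∫⁻ y, F (x, y) * ∫⁻ v, ENNReal.ofReal (jetIntegrand m z x y v) ∂gaussVec m := by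
  have hm : Measurable fun q : ℂ × ℂ × (Fin m → ℂ) =>
      F (q.1 + sqrtDeg m * z * q.2.1 + tailEval m q.2.2 z,
        q.2.1 + tailEvalDeriv m q.2.2 z / sqrtDeg m)
        * ENNReal.ofReal (‖tailEvalDeriv2 m q.2.2 z‖ ^ 2) := by
    refine (hF.comp (Continuous.measurable ?_)).mul
      (Measurable.ennreal_ofReal (Continuous.measurable ?_)) <;> fun_prop
  rw [lintegral_lintegral_lintegral_reverse (f := fun a₀ a₁ v =>
    F (a₀ + sqrtDeg m * z * a₁ + tailEval m v z,
        a₁ + tailEvalDeriv m v z / sqrtDeg m)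
          * ENNReal.ofReal (‖tailEvalDeriv2 m v z‖ ^ 2)) _ _ _ hm]
  have hm2 : Measurable fun q : ℂ × ℂ × (Fin m → ℂ) =>
      F (q.1, q.2.1) * ENNReal.ofReal (jetIntegrand m z q.1 q.2.1 q.2.2) := by
    refine (hF.comp (by fun_prop)).mul (Measurable.ennreal_ofReal (Continuous.measurable ?_))
    fun_prop
  have hv : ∀ v, ∫⁻ a₁, ∫⁻ a₀, F (a₀ + sqrtDeg m * z * a₁ + tailEval m v z,
        a₁ + tailEvalDeriv m v z / sqrtDeg m) * ENNReal.ofReal (‖tailEvalDeriv2 m v z‖ ^ 2)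
        ∂stdComplexGaussian ∂stdComplexGaussian
      = ∫⁻ y, ∫⁻ x, F (x, y) * ENNReal.ofReal (jetIntegrand m z x y v) := by
    intro v
    have hmv : Measurable fun q : ℂ × ℂ =>
      F (q.2 + sqrtDeg m * z * q.1 + tailEval m v z,
        q.1 + tailEvalDeriv m v z / sqrtDeg m)
        * ENNReal.ofReal (‖tailEvalDeriv2 m v z‖ ^ 2) :=
      hm.comp (by fun_prop : Measurable fun q : ℂ × ℂ => (q.2, q.1, v))
    rw [lintegral_stdComplexGaussian (Measurable.lintegral_prod_right' hmv),
      ← lintegral_sub_right_eq_self _ (tailEvalDeriv m v z / sqrtDeg m)]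
    refine lintegral_congr fun y => ?_
    have hmy := hmv.comp (measurable_prodMk_left (x := y - tailEvalDeriv m v z / sqrtDeg m))
    simp only [Function.comp_def] at hmy
    rw [lintegral_stdComplexGaussian hmy,
      ← lintegral_sub_right_eq_self _
        (sqrtDeg m * z * (y - tailEvalDeriv m v z / sqrtDeg m) + tailEval m v z),
      ← lintegral_const_mul' _ _ ENNReal.ofReal_ne_top]
    refine lintegral_congr fun x => ?_
    simp only [jetIntegrand]
    rw [ENNReal.ofReal_mul (gaussDensity_nonneg _), ENNReal.ofReal_mul (gaussDensity_nonneg _)]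
    have e1 : x - (sqrtDeg m * z * (y - tailEvalDeriv m v z / sqrtDeg m) + tailEval m v z)
        + sqrtDeg m * z * (y - tailEvalDeriv m v z / sqrtDeg m) + tailEval m v z = x := by ring
    rw [e1, sub_add_cancel]
    ring
  simp_rw [hv]
  rw [← lintegral_lintegral_lintegral_reverse (f := fun x y v =>
    F (x, y) * ENNReal.ofReal (jetIntegrand m z x y v)) _ _ _ hm2]
  refine lintegral_congr fun x => lintegral_congr fun y => lintegral_const_mul _ ?_
  refine Measurable.ennreal_ofReal (Continuous.measurable ?_)
  fun_prop

/-- The weighted joint density of `(p(z), p'(z)/√n)` in closed form. -/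
def jetDensity (m : ℕ) (z x y : ℂ) : ℝ :=
  (‖rootKernel m z‖ ^ 2)⁻¹ * (gaussDensity (x / rootKernel m z) * ((‖rootKernel' m z‖ ^ 2)⁻¹
    * (gaussDensity ((y - rootKernel' m z * (sqrtDeg m * starRingEnd ℂ z) * (x / rootKernel m z))
        / rootKernel' m z)
      * (‖jetShift m z (x / rootKernel m z)
          ((y - rootKernel' m z * (sqrtDeg m * starRingEnd ℂ z) * (x / rootKernel m z))
            / rootKernel' m z)‖ ^ 2 + ‖jetSigma m z‖ ^ 2))))

theorem jetDensity_nonneg (m : ℕ) (z x y : ℂ) : 0 ≤ jetDensity m z x y := by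
  unfold jetDensity
  have h1 := gaussDensity_nonneg (x / rootKernel m z)
  have h2 := gaussDensity_nonneg ((y - rootKernel' m z * (sqrtDeg m * starRingEnd ℂ z)
    * (x / rootKernel m z)) / rootKernel' m z)
  positivity

theorem continuous_jetDensity (m : ℕ) (z : ℂ) :
    Continuous fun q : ℂ × ℂ => jetDensity m z q.1 q.2 := by
  unfold jetDensity jetShift
  fun_prop

theorem rootKernel_ne_zero (m : ℕ) (z : ℂ) : rootKernel m z ≠ 0 := by
  rw [rootKernel]
  exact_mod_cast (Real.sqrt_pos.2 (by positivity)).ne'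

theorem rootKernel'_ne_zero (m : ℕ) (z : ℂ) : rootKernel' m z ≠ 0 := by
  rw [rootKernel']
  refine div_ne_zero (rootKernel_ne_zero m z) ?_
  exact_mod_cast (by positivity : (1 + ‖z‖ ^ 2) ≠ 0)

/-- The third Gaussian only enters through p'' and integrates out by its second moment; two complex
affine substitutions then give the inverse squared moduli in `jetDensity`. -/
theorem lintegral_jet_right (m : ℕ) (z : ℂ) {F : ℂ × ℂ → ℝ≥0∞} (hF : Measurable F) :
    ∫⁻ b₀, ∫⁻ b₁, ∫⁻ b₂, F (rootKernel m z * b₀,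
          rootKernel' m z * b₁ + rootKernel' m z * (sqrtDeg m * starRingEnd ℂ z) * b₀)
          * ENNReal.ofReal (‖jetShift m z b₀ b₁ + jetSigma m z * b₂‖ ^ 2)
          ∂stdComplexGaussian ∂stdComplexGaussian ∂stdComplexGaussian
      = ∫⁻ x, ∫⁻ y, F (x, y) * ENNReal.ofReal (jetDensity m z x y) := by
  have hζ := rootKernel_ne_zero m z
  have hκ := rootKernel'_ne_zero m z
  set ζ := rootKernel m z
  set κ := rootKernel' m z
  set c := sqrtDeg m * starRingEnd ℂ z
  have h1 : ∀ b₀ b₁, ∫⁻ b₂, F (ζ * b₀, κ * b₁ + κ * c * b₀)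
          * ENNReal.ofReal (‖jetShift m z b₀ b₁ + jetSigma m z * b₂‖ ^ 2) ∂stdComplexGaussian
      = F (ζ * b₀, κ * b₁ + κ * c * b₀)
        * ENNReal.ofReal (‖jetShift m z b₀ b₁‖ ^ 2 + ‖jetSigma m z‖ ^ 2) := by
    intro b₀ b₁
    rw [lintegral_const_mul _ (Measurable.ennreal_ofReal (Continuous.measurable (by fun_prop))),
      lintegral_norm_sq_affine_stdComplexGaussian]
  simp_rw [h1]
  have hm : Measurable fun b : ℂ × ℂ => F (ζ * b.1, κ * b.2 + κ * c * b.1)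
        * ENNReal.ofReal (‖jetShift m z b.1 b.2‖ ^ 2 + ‖jetSigma m z‖ ^ 2) := by
    refine (hF.comp (Continuous.measurable ?_)).mul
      (Measurable.ennreal_ofReal (Continuous.measurable ?_))
    · fun_prop
    · unfold jetShift; fun_prop
  rw [lintegral_stdComplexGaussian (Measurable.lintegral_prod_right' hm)]
  let T : ℂ → ℝ≥0∞ := fun x => ENNReal.ofReal (gaussDensity (x / ζ)) *
    ∫⁻ b₁, F (x, κ * b₁ + κ * c * (x / ζ))
        * ENNReal.ofReal (‖jetShift m z (x / ζ) b₁‖ ^ 2 + ‖jetSigma m z‖ ^ 2) ∂stdComplexGaussian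
  have h2 := lintegral_comp_affine hζ 0 T
  simp only [add_zero, T, mul_div_cancel_left₀ _ hζ] at h2
  rw [h2, ← lintegral_const_mul' _ _ ENNReal.ofReal_ne_top]
  refine lintegral_congr fun x => ?_
  have hx : Measurable fun b₁ => F (x, κ * b₁ + κ * c * (x / ζ))
        * ENNReal.ofReal (‖jetShift m z (x / ζ) b₁‖ ^ 2 + ‖jetSigma m z‖ ^ 2) := by
    refine (hF.comp (Continuous.measurable ?_)).mul
      (Measurable.ennreal_ofReal (Continuous.measurable ?_))
    · fun_prop
    · unfold jetShift; fun_prop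
  rw [lintegral_stdComplexGaussian hx]
  let U : ℂ → ℝ≥0∞ := fun y => ENNReal.ofReal (gaussDensity ((y - κ * c * (x / ζ)) / κ)) *
    (F (x, y) * ENNReal.ofReal (‖jetShift m z (x / ζ) ((y - κ * c * (x / ζ)) / κ)‖ ^ 2
      + ‖jetSigma m z‖ ^ 2))
  have h3 := lintegral_comp_affine hκ (κ * c * (x / ζ)) U
  simp only [U, add_sub_cancel_right, mul_div_cancel_left₀ _ hκ] at h3
  rw [h3, ← lintegral_const_mul' _ _ ENNReal.ofReal_ne_top,
    ← lintegral_const_mul' _ _ ENNReal.ofReal_ne_top,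
    ← lintegral_const_mul' _ _ ENNReal.ofReal_ne_top]
  refine lintegral_congr fun y => ?_
  rw [jetDensity, ENNReal.ofReal_mul (by positivity), ENNReal.ofReal_mul (gaussDensity_nonneg _),
    ENNReal.ofReal_mul (by positivity), ENNReal.ofReal_mul (gaussDensity_nonneg _)]
  ring

theorem integrable_norm_sq_tailEvalDeriv2 (m : ℕ) (z : ℂ) :
    Integrable (fun v => ‖tailEvalDeriv2 m v z‖ ^ 2) (gaussVec m) := by
  refine (memLp_two_iff_integrable_sq_norm ?_).1 ?_
  · exact (Continuous.aestronglyMeasurable (by fun_prop))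
  · unfold tailEvalDeriv2
    refine memLp_finsetSum _ fun i _ => ?_
    have h := memLp_two_stdComplexGaussian.comp_measurePreserving
      (measurePreserving_eval (fun _ : Fin m => stdComplexGaussian) i)
    exact h.mul_const (tailCoeffDeriv2 m i z)

theorem jetIntegrand_le (m : ℕ) (z x y : ℂ) (v : Fin m → ℂ) :
    jetIntegrand m z x y v ≤ ‖tailEvalDeriv2 m v z‖ ^ 2 := by
  refine mul_le_of_le_one_left ?_ (gaussDensity_le _) |>.trans
    (mul_le_of_le_one_left (by positivity) (gaussDensity_le _))
  exact mul_nonneg (gaussDensity_nonneg _) (by positivity)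

theorem continuous_integral_jetIntegrand (m : ℕ) (z : ℂ) :
    Continuous fun q : ℂ × ℂ => ∫ v, jetIntegrand m z q.1 q.2 v ∂gaussVec m := by
  refine continuous_of_dominated (bound := fun v => ‖tailEvalDeriv2 m v z‖ ^ 2)
    (fun q => Continuous.aestronglyMeasurable (by fun_prop)) (fun q => ae_of_all _ fun v => ?_)
    (integrable_norm_sq_tailEvalDeriv2 m z) (ae_of_all _ fun v => by fun_prop)
  rw [Real.norm_of_nonneg (jetIntegrand_nonneg _ _ _ _ _)]
  exact jetIntegrand_le _ _ _ _ _

theorem lintegral_jetIntegrand (m : ℕ) (z x y : ℂ) :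
    ∫⁻ v, ENNReal.ofReal (jetIntegrand m z x y v) ∂gaussVec m
      = ENNReal.ofReal (∫ v, jetIntegrand m z x y v ∂gaussVec m) := by
  refine (ofReal_integral_eq_lintegral_ofReal ?_
    (ae_of_all _ (jetIntegrand_nonneg m z x y))).symm
  refine (integrable_norm_sq_tailEvalDeriv2 m z).mono'
    (Continuous.aestronglyMeasurable (by fun_prop)) (ae_of_all _ fun v => ?_)
  rw [Real.norm_of_nonneg (jetIntegrand_nonneg _ _ _ _ _)]
  exact jetIntegrand_le _ _ _ _ _

/-- Both sides are densities of the same |p''|²-weighted law of (p, p'/√n), hence equal almost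
everywhere. Continuity in (x, y) makes the equality pointwise, which is essential because it is used
on the null set y = 0. -/
theorem integral_jetIntegrand_eq (m : ℕ) {z : ℂ} (hz : z ≠ 0) (x y : ℂ) :
    ∫ v, jetIntegrand m z x y v ∂gaussVec m = jetDensity m z x y := by
  have hcont := continuous_integral_jetIntegrand m z
  have key : ∀ F : ℂ × ℂ → ℝ≥0∞, Measurable F →
      ∫⁻ q, F q * ENNReal.ofReal (∫ v, jetIntegrand m z q.1 q.2 v ∂gaussVec m)
        ∂(volume.prod volume)
      = ∫⁻ q, F q * ENNReal.ofReal (jetDensity m z q.1 q.2) ∂(volume.prod volume) := by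
    intro F hF
    have h := lintegral_jet_eq m hz (Ψ := fun q => F (q.1, q.2.1) * ENNReal.ofReal (‖q.2.2‖ ^ 2))
      (by fun_prop)
    rw [lintegral_jet_left m z hF, lintegral_jet_right m z hF] at h
    simp_rw [lintegral_jetIntegrand] at h
    exact (lintegral_prod _ (hF.mul hcont.measurable.ennreal_ofReal).aemeasurable).trans
      (h.trans (lintegral_prod _
        (hF.mul (continuous_jetDensity m z).measurable.ennreal_ofReal).aemeasurable).symm)
  have hae : (fun q : ℂ × ℂ => ENNReal.ofReal (∫ v, jetIntegrand m z q.1 q.2 v ∂gaussVec m))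
      =ᵐ[volume.prod volume] fun q => ENNReal.ofReal (jetDensity m z q.1 q.2) := by
    refine ae_eq_of_forall_setLIntegral_eq_of_sigmaFinite hcont.measurable.ennreal_ofReal
      (continuous_jetDensity m z).measurable.ennreal_ofReal fun s hs _ => ?_
    have h := key (s.indicator 1) (measurable_one.indicator hs)
    rw [← lintegral_indicator hs, ← lintegral_indicator hs]
    refine Eq.trans (lintegral_congr fun q => ?_) (h.trans (lintegral_congr fun q => ?_)) <;>
    · by_cases hq : q ∈ s <;> simp [hq]
  have hae2 : (fun q : ℂ × ℂ => ∫ v, jetIntegrand m z q.1 q.2 v ∂gaussVec m)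
      =ᵐ[volume.prod volume] fun q => jetDensity m z q.1 q.2 := by
    filter_upwards [hae] with q hq
    exact (ENNReal.ofReal_eq_ofReal_iff
      (integral_nonneg fun v => jetIntegrand_nonneg m z q.1 q.2 v)
      (jetDensity_nonneg m z q.1 q.2)).1 hq
  have := (Continuous.ae_eq_iff_eq _ hcont (continuous_jetDensity m z)).1 hae2
  exact congrFun this (x, y)

/-- The Kac-Rice integrand in terms of `r = |z|²` and `c = |x|²`, for degree `n = m + 1`. -/
def kacRice (m : ℕ) (r c : ℝ) : ℝ :=
  Real.pi⁻¹ ^ 2 * (m * ((m + 1) * m * r ^ 2 * c + 2 * (1 + r) ^ (m + 1)))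
    / (((1 + r) ^ (m + 1)) ^ 2 * (1 + r) ^ 2)
    * Real.exp (-((1 + (m + 1) * r) * c / (1 + r) ^ (m + 1)))

theorem jetDensity_zero (m : ℕ) (z x : ℂ) :
    jetDensity m z x 0 = (m + 1) * kacRice m (‖z‖ ^ 2) (‖x‖ ^ 2) := by
  have hζ := rootKernel_ne_zero m z
  have hκ := rootKernel'_ne_zero m z
  have hζn := norm_rootKernel_sq m z
  have hs := norm_sqrtDeg_sq m
  have hs2 := sqrtDeg_sq m
  set r : ℝ := ‖z‖ ^ 2 with hr
  have hr0 : 0 ≤ r := by positivity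
  have hκn : ‖rootKernel' m z‖ ^ 2 = (1 + r) ^ (m + 1) / (1 + r) ^ 2 := by
    rw [rootKernel', norm_div, div_pow, hζn, Complex.norm_real, Real.norm_eq_abs, sq_abs]
  have hb1 : (0 - rootKernel' m z * (sqrtDeg m * starRingEnd ℂ z) * (x / rootKernel m z))
      / rootKernel' m z = -(sqrtDeg m * starRingEnd ℂ z * (x / rootKernel m z)) := by
    field_simp; ring
  have hb0n : ‖x / rootKernel m z‖ ^ 2 = ‖x‖ ^ 2 / (1 + r) ^ (m + 1) := by
    rw [norm_div, div_pow, hζn]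
  have hb1n : ‖-(sqrtDeg m * starRingEnd ℂ z * (x / rootKernel m z))‖ ^ 2
      = (m + 1) * r * (‖x‖ ^ 2 / (1 + r) ^ (m + 1)) := by
    rw [norm_neg, norm_mul, norm_mul, mul_pow, mul_pow, hb0n, hs, RCLike.norm_conj]
  -- At y = 0 the second Gaussian coordinate is a multiple of the first, and by s² = n the two terms
  -- of `jetShift` are in ratio 1 : -2.
  have hshift : jetShift m z (x / rootKernel m z)
      (-(sqrtDeg m * starRingEnd ℂ z * (x / rootKernel m z)))
      = -((m + 1) * m * starRingEnd ℂ z ^ 2 * x / ((1 + r) ^ 2 : ℝ)) := by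
    rw [jetShift, ← hr]
    have hR : (((1 + r) ^ 2 : ℝ) : ℂ) ≠ 0 := by
      exact_mod_cast (by positivity : ((1 + r) ^ 2) ≠ 0)
    field_simp
    linear_combination (-2 * (m : ℂ) * starRingEnd ℂ z ^ 2 * x) * hs2
  have hshiftn : ‖-(((m : ℂ) + 1) * m * starRingEnd ℂ z ^ 2 * x / ((1 + r) ^ 2 : ℝ))‖ ^ 2
      = (m + 1) ^ 2 * m ^ 2 * r ^ 2 * ‖x‖ ^ 2 / (1 + r) ^ 4 := by
    have hm1 : ‖(m : ℂ) + 1‖ = m + 1 := by exact_mod_cast Complex.norm_natCast (m + 1)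
    rw [norm_neg, norm_div, norm_mul, norm_mul, norm_mul, norm_pow, RCLike.norm_conj,
      Complex.norm_natCast, hm1, Complex.norm_real, Real.norm_eq_abs, abs_of_nonneg (by positivity),
      ← hr]
    field_simp
  have hsigma : ‖jetSigma m z‖ ^ 2 = (1 + r) ^ (m + 1) * (2 * (m + 1) * m) / (1 + r) ^ 4 := by
    rw [jetSigma, norm_mul, norm_div, mul_pow, div_pow, hζn, ← hr, Complex.norm_real,
      Complex.norm_real, Real.norm_eq_abs, Real.norm_eq_abs, sq_abs, sq_abs,
      Real.sq_sqrt (by positivity)]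
    field_simp
  rw [jetDensity, hb1, hshift, hshiftn, hsigma, hζn, hκn, gaussDensity, gaussDensity, hb0n, hb1n,
    kacRice]
  have hexp : Real.exp (-((1 + (m + 1) * r) * ‖x‖ ^ 2 / (1 + r) ^ (m + 1)))
      = Real.exp (-(‖x‖ ^ 2 / (1 + r) ^ (m + 1)))
        * Real.exp (-((m + 1) * r * (‖x‖ ^ 2 / (1 + r) ^ (m + 1)))) := by
    rw [← Real.exp_add]; congr 1; ring
  rw [hexp]
  field_simp

/-! ### Critical points as fibres, and the Kac-Rice formula. -/

theorem eval_su2Poly (m : ℕ) (c : ℕ → ℂ) (z : ℂ) :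
    (su2Poly (m + 1) c).eval z
      = c 0 + sqrtDeg m * z * c 1 + tailEval m (fun i : Fin m => c (i + 2)) z := by
  rw [su2Poly, eval_finsetSum, Finset.sum_range_succ', Finset.sum_range_succ',
    Finset.sum_range, tailEval]
  simp only [eval_mul, eval_C, eval_pow, eval_X, tailCoeff, sqrtDeg]
  have h : ∀ i : Fin m, c (i + 1 + 1) * (Real.sqrt ((m + 1).choose (i + 1 + 1) : ℝ) : ℂ)
      * z ^ ((i : ℕ) + 1 + 1) = c (i + 2) * ((Real.sqrt ((m + 1).choose (i + 2) : ℝ) : ℂ)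
      * z ^ ((i : ℕ) + 2)) := fun i => mul_assoc _ _ _
  simp_rw [h]
  simp
  ring

theorem eval_derivative_su2Poly (m : ℕ) (c : ℕ → ℂ) (z : ℂ) :
    (su2Poly (m + 1) c).derivative.eval z
      = sqrtDeg m * c 1 + tailEvalDeriv m (fun i : Fin m => c (i + 2)) z := by
  rw [su2Poly, derivative_sum, eval_finsetSum, Finset.sum_range_succ', Finset.sum_range_succ',
    Finset.sum_range, tailEvalDeriv]
  simp only [derivative_C_mul_X_pow, eval_mul, eval_C, eval_pow, eval_X, tailCoeffDeriv, sqrtDeg]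
  have h : ∀ i : Fin m, c (i + 1 + 1) * (Real.sqrt ((m + 1).choose (i + 1 + 1) : ℝ) : ℂ)
      * ((i + 1 + 1 : ℕ) : ℂ) * z ^ ((i : ℕ) + 1 + 1 - 1)
      = c (i + 2) * ((Real.sqrt ((m + 1).choose (i + 2) : ℝ) : ℂ)
      * (((i + 2 : ℕ) : ℂ) * z ^ ((i : ℕ) + 1))) := by
    intro i
    rw [Nat.add_sub_cancel]
    ring
  simp_rw [h]
  simp
  ring

/-- The linear coefficient `a₁` for which `z` is a critical point, given the other
coefficients. -/
def critCoeff (m : ℕ) (q : ℂ × (Fin m → ℂ) × ℂ) : ℂ := -(tailEvalDeriv m q.2.1 q.1 / sqrtDeg m)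

/-- The critical value at `z`, given the coefficients other than `a₁`. -/
def critValue (m : ℕ) (q : ℂ × (Fin m → ℂ) × ℂ) : ℂ :=
  q.2.2 + sqrtDeg m * q.1 * critCoeff m q + tailEval m q.2.1 q.1

theorem contDiff_critCoeff (m : ℕ) : ContDiff ℂ 1 (critCoeff m) := by
  unfold critCoeff tailEvalDeriv tailCoeffDeriv
  fun_prop

@[fun_prop]
theorem continuous_critCoeff (m : ℕ) : Continuous (critCoeff m) :=
  (contDiff_critCoeff m).continuous

@[fun_prop]
theorem continuous_critValue (m : ℕ) : Continuous (critValue m) := by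
  unfold critValue; fun_prop

theorem fderiv_critCoeff (m : ℕ) (q : ℂ × (Fin m → ℂ) × ℂ) :
    fderiv ℂ (critCoeff m) q (1, 0) = -(tailEvalDeriv2 m q.2.1 q.1 / sqrtDeg m) := by
  have h1 : HasFDerivAt (critCoeff m) (fderiv ℂ (critCoeff m) q) q :=
    ((contDiff_critCoeff m).differentiable (by simp) q).hasFDerivAt
  have h2 : HasDerivAt (fun t : ℂ => ((t, q.2) : ℂ × (Fin m → ℂ) × ℂ)) (1, 0) q.1 :=
    (hasDerivAt_id q.1).prodMk (hasDerivAt_const q.1 q.2)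
  have h3 := HasFDerivAt.comp_hasDerivAt q.1 (l := critCoeff m)
    (f := fun t : ℂ => ((t, q.2) : ℂ × (Fin m → ℂ) × ℂ)) h1 h2
  have h4 : HasDerivAt (fun t : ℂ => tailEvalDeriv m q.2.1 t) (tailEvalDeriv2 m q.2.1 q.1) q.1 := by
    unfold tailEvalDeriv tailEvalDeriv2
    refine HasDerivAt.fun_sum fun i _ => HasDerivAt.const_mul _ ?_
    unfold tailCoeffDeriv tailCoeffDeriv2
    refine HasDerivAt.const_mul _ (HasDerivAt.const_mul _ ?_)
    simpa using hasDerivAt_pow ((i : ℕ) + 1) q.1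
  exact h3.unique (h4.div_const _).neg

/-- The coefficient `a₁`, the coefficients of degree at least two, and `a₀`. -/
def splitCoeffs (m : ℕ) (c : ℕ → ℂ) : ℂ × (Fin m → ℂ) × ℂ := (c 1, fun i => c (i + 2), c 0)

/-- Since p'(0) = √n·c₁, the condition on c₁ excludes p' = 0 identically, the one case in which
`critPoints` differs from the fibre. -/
theorem lintegral_critValueMeasure (m : ℕ) {c : ℕ → ℂ} (hc : c 1 ≠ 0) {f : ℂ → ℝ≥0∞}
    (hf : Measurable f) :
    ∫⁻ w, f w ∂critValueMeasure (su2Poly (m + 1) c)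
      = ∑' z : {z | critCoeff m (z, (splitCoeffs m c).2) = (splitCoeffs m c).1},
          f (critValue m (z, (splitCoeffs m c).2)) := by
  have hs := sqrtDeg_ne_zero m
  have hne : (su2Poly (m + 1) c).derivative ≠ 0 := by
    intro h
    have h0 := eval_derivative_su2Poly m c 0
    rw [h] at h0
    simp [tailEvalDeriv, tailCoeffDeriv, hs, hc] at h0
  have hmem : ∀ z, z ∈ critPoints (su2Poly (m + 1) c)
      ↔ critCoeff m (z, (splitCoeffs m c).2) = (splitCoeffs m c).1 := by
    intro z
    rw [mem_critPoints hne, eval_derivative_su2Poly]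
    simp only [critCoeff, splitCoeffs]
    constructor
    · intro h
      field_simp
      linear_combination -h
    · intro h
      rw [← h]
      field_simp
      ring
  have hval : ∀ z ∈ critPoints (su2Poly (m + 1) c),
      (su2Poly (m + 1) c).eval z = critValue m (z, (splitCoeffs m c).2) := by
    intro z hz
    rw [eval_su2Poly, critValue, (hmem z).1 hz]
    rfl
  have hset : {z | critCoeff m (z, (splitCoeffs m c).2) = (splitCoeffs m c).1}
      = (critPoints (su2Poly (m + 1) c) : Set ℂ) := by
    ext z; exact (hmem z).symm
  rw [hset, critValueMeasure, lintegral_finsetSum_measure]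
  rw [Finset.tsum_subtype' (critPoints (su2Poly (m + 1) c))
    fun z => f (critValue m (z, (splitCoeffs m c).2))]
  refine Finset.sum_congr rfl fun z hz => ?_
  rw [lintegral_dirac' _ hf, hval z hz]

theorem map_splitCoeffs {Ω : Type*} [MeasurableSpace Ω] (P : Measure Ω) [IsProbabilityMeasure P]
    (a : ℕ → Ω → ℂ) (ha_indep : iIndepFun a P)
    (ha_law : ∀ j, HasLaw (a j) stdComplexGaussian P) (m : ℕ) :
    AEMeasurable (fun ω => splitCoeffs m fun j => a j ω) P ∧
    Measure.map (fun ω => splitCoeffs m fun j => a j ω) P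
      = stdComplexGaussian.prod ((gaussVec m).prod stdComplexGaussian) := by
  have hm : ∀ j, AEMeasurable (a j) P := fun j => (ha_law j).aemeasurable
  have hvec : AEMeasurable (fun ω (i : Fin (m + 2)) => a i ω) P :=
    aemeasurable_pi_lambda _ fun i => hm i
  have hpi : Measure.map (fun ω (i : Fin (m + 2)) => a i ω) P
      = Measure.pi fun _ => stdComplexGaussian := by
    rw [(iIndepFun_iff_map_fun_eq_pi_map (f := fun i : Fin (m + 2) => a i) fun i => hm i).1
      (ha_indep.precomp Fin.val_injective)]
    simp_rw [(ha_law _).map_eq]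
  have hre : MeasurePreserving (fun q : ℂ × ℂ × (Fin m → ℂ) => (q.2.1, q.2.2, q.1))
      (stdComplexGaussian.prod (stdComplexGaussian.prod (gaussVec m)))
      (stdComplexGaussian.prod ((gaussVec m).prod stdComplexGaussian)) :=
    (measurePreserving_prodAssoc _ _ _).comp Measure.measurePreserving_swap
  have hcomp := hre.comp (measurePreserving_splitTwo m)
  have heq : (fun ω => splitCoeffs m fun j => a j ω)
      = ((fun q : ℂ × ℂ × (Fin m → ℂ) => (q.2.1, q.2.2, q.1)) ∘
        fun a : Fin (m + 2) → ℂ => (a 0, a 1, fun i : Fin m => a i.succ.succ))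
        ∘ fun ω (i : Fin (m + 2)) => a i ω := rfl
  rw [heq]
  refine ⟨hcomp.measurable.comp_aemeasurable hvec, ?_⟩
  rw [← AEMeasurable.map_map_of_aemeasurable (hcomp.measurable.aemeasurable) hvec, hpi,
    hcomp.map_eq]

/-- The Kac-Rice formula for the critical values, in integrated form over the position `z` of the
critical point. -/
theorem lintegral_sum_critValue (m : ℕ) {f : ℂ → ℝ≥0∞} (hf : Measurable f) :
    AEMeasurable (fun y : ℂ × (Fin m → ℂ) × ℂ =>
        ∑' z : {z | critCoeff m (z, y.2) = y.1}, f (critValue m (z, y.2)))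
      (stdComplexGaussian.prod ((gaussVec m).prod stdComplexGaussian)) ∧
    ∫⁻ y, ∑' z : {z | critCoeff m (z, y.2) = y.1}, f (critValue m (z, y.2))
        ∂(stdComplexGaussian.prod ((gaussVec m).prod stdComplexGaussian))
      = ∫⁻ z : ℂ, ∫⁻ x : ℂ, f x * ENNReal.ofReal (kacRice m (‖z‖ ^ 2) (‖x‖ ^ 2)) := by
  set ν := (gaussVec m).prod stdComplexGaussian with hν
  have : IsProbabilityMeasure ν := by rw [hν]; infer_instance
  have : SigmaFinite (volume : Measure ((Fin m → ℂ) × ℂ)) := by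
    rw [Measure.volume_eq_prod]; infer_instance
  have : (volume : Measure ((Fin m → ℂ) × ℂ)).IsAddHaarMeasure := by
    rw [Measure.volume_eq_prod]; exact Measure.prod.instIsAddHaarMeasure _ _
  have hγac : stdComplexGaussian ≪ volume := withDensity_absolutelyContinuous _ _
  have hνac : ν ≪ volume := (pi_stdComplexGaussian_absolutelyContinuous m).prod hγac
  -- Only the existence of a density for (v, a₀) matters: it is carried through the area formula and
  -- then reabsorbed into `ν`.
  obtain ⟨w, hw, hνw⟩ : ∃ w : (Fin m → ℂ) × ℂ → ℝ≥0∞, Measurable w ∧ ν = volume.withDensity w :=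
    ⟨ν.rnDeriv volume, Measure.measurable_rnDeriv _ _, (Measure.withDensity_rnDeriv_eq _ _ hνac).symm⟩
  have hprod : stdComplexGaussian.prod ν = ((volume : Measure ℂ).prod volume).withDensity
      fun y => ENNReal.ofReal (gaussDensity y.1) * w y.2 := by
    rw [hνw, stdComplexGaussian_eq, prod_withDensity measurable_ofReal_gaussDensity hw]
  have hfP : Measurable fun q => f (critValue m q) := hf.comp (continuous_critValue m).measurable
  have hae := (fiber_area_formula (volume : Measure ((Fin m → ℂ) × ℂ)) (contDiff_critCoeff m)
    hfP).1
  have hac : stdComplexGaussian.prod ν ≪ (volume : Measure ℂ).prod volume := hγac.prod hνac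
  refine ⟨hae.mono_ac hac, ?_⟩
  have hdens : Measurable fun y : ℂ × (Fin m → ℂ) × ℂ =>
      ENNReal.ofReal (gaussDensity y.1) * w y.2 :=
    (measurable_ofReal_gaussDensity.comp measurable_fst).mul (hw.comp measurable_snd)
  rw [hprod, lintegral_withDensity_eq_lintegral_mul₀ hdens.aemeasurable hae]
  -- On the fibre a₁ equals `critCoeff`, so the density of a₁ can move inside the sum over critical
  -- points.
  let F : ℂ × (Fin m → ℂ) × ℂ → ℝ≥0∞ := fun q =>
    ENNReal.ofReal (gaussDensity (critCoeff m q)) * w q.2 * f (critValue m q)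
  have hF : Measurable F :=
    ((measurable_ofReal_gaussDensity.comp (continuous_critCoeff m).measurable).mul
      (hw.comp measurable_snd)).mul hfP
  have hsum : ∀ y : ℂ × (Fin m → ℂ) × ℂ, ((fun y : ℂ × (Fin m → ℂ) × ℂ =>
      ENNReal.ofReal (gaussDensity y.1) * w y.2) *
      fun y : ℂ × (Fin m → ℂ) × ℂ => ∑' z : {z | critCoeff m (z, y.2) = y.1}, f (critValue m (z, y.2))) y
      = ∑' z : {z | critCoeff m (z, y.2) = y.1}, F (z, y.2) := by
    intro y
    rw [Pi.mul_apply, ← ENNReal.tsum_mul_left]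
    refine tsum_congr fun z => ?_
    have hz : critCoeff m (z, y.2) = y.1 := z.2
    simp only [F, hz]
  simp_rw [hsum]
  rw [(fiber_area_formula (volume : Measure ((Fin m → ℂ) × ℂ)) (contDiff_critCoeff m) hF).2]
  have hK : Continuous fun q : ℂ × (Fin m → ℂ) × ℂ => ‖fderiv ℂ (critCoeff m) q (1, 0)‖ ^ 2 := by
    simp_rw [fderiv_critCoeff]
    fun_prop
  refine (lintegral_prod _ (hK.measurable.ennreal_ofReal.mul hF).aemeasurable).trans ?_
  simp only [Pi.mul_apply]
  have hz0 : ∀ᵐ z : ℂ, z ≠ 0 := by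
    rw [ae_iff]
    simp
  refine lintegral_congr_ae (hz0.mono fun z hz => ?_)
  have hs := sqrtDeg_ne_zero m
  have h1 : ∀ u : (Fin m → ℂ) × ℂ,
      ENNReal.ofReal (‖fderiv ℂ (critCoeff m) (z, u) (1, 0)‖ ^ 2) * F (z, u)
      = w u * (ENNReal.ofReal (((m : ℝ) + 1)⁻¹ * (gaussDensity (critCoeff m (z, u))
        * ‖tailEvalDeriv2 m u.1 z‖ ^ 2)) * f (critValue m (z, u))) := by
    intro u
    have e : ((m : ℝ) + 1)⁻¹ * (gaussDensity (critCoeff m (z, u)) * ‖tailEvalDeriv2 m u.1 z‖ ^ 2)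
        = ‖fderiv ℂ (critCoeff m) (z, u) (1, 0)‖ ^ 2 * gaussDensity (critCoeff m (z, u)) := by
      rw [fderiv_critCoeff, norm_neg, norm_div, div_pow, norm_sqrtDeg_sq]
      ring
    rw [e, ENNReal.ofReal_mul (by positivity)]
    simp only [F]
    ring
  simp_rw [h1]
  have hm1 : Measurable fun u : (Fin m → ℂ) × ℂ =>
      ENNReal.ofReal (((m : ℝ) + 1)⁻¹ * (gaussDensity (critCoeff m (z, u))
        * ‖tailEvalDeriv2 m u.1 z‖ ^ 2)) * f (critValue m (z, u)) := by
    refine (Measurable.ennreal_ofReal (Continuous.measurable ?_)).mul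
      (hfP.comp measurable_prodMk_left)
    fun_prop
  have h2 := lintegral_withDensity_eq_lintegral_mul volume hw hm1
  rw [← hνw] at h2
  refine h2.symm.trans ?_
  rw [hν, lintegral_prod _ hm1.aemeasurable]
  have hm2 : Measurable fun q : (Fin m → ℂ) × ℂ => f q.2
      * ENNReal.ofReal (((m : ℝ) + 1)⁻¹ * jetIntegrand m z q.2 0 q.1) := by
    refine (hf.comp measurable_snd).mul (Measurable.ennreal_ofReal (Continuous.measurable ?_))
    fun_prop
  have h3 : ∀ v, ∫⁻ a₀, ENNReal.ofReal (((m : ℝ) + 1)⁻¹ * (gaussDensity (critCoeff m (z, v, a₀))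
        * ‖tailEvalDeriv2 m v z‖ ^ 2)) * f (critValue m (z, v, a₀)) ∂stdComplexGaussian
      = ∫⁻ x, f x * ENNReal.ofReal (((m : ℝ) + 1)⁻¹ * jetIntegrand m z x 0 v) := by
    intro v
    have hmv := hm1.comp (measurable_prodMk_left (x := v))
    simp only [Function.comp_def] at hmv
    -- Translating a₀ makes the critical value itself the integration variable and produces
    -- `jetIntegrand` at y = 0.
    rw [lintegral_stdComplexGaussian hmv, ← lintegral_sub_right_eq_self _
      (sqrtDeg m * z * (0 - tailEvalDeriv m v z / sqrtDeg m) + tailEval m v z)]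
    refine lintegral_congr fun x => ?_
    simp only [critValue, critCoeff, jetIntegrand, zero_sub]
    have e : x - (sqrtDeg m * z * -(tailEvalDeriv m v z / sqrtDeg m) + tailEval m v z)
        + sqrtDeg m * z * -(tailEvalDeriv m v z / sqrtDeg m) + tailEval m v z = x := by ring
    rw [e, ← mul_assoc, ← ENNReal.ofReal_mul (gaussDensity_nonneg _), mul_comm (f x)]
    congr 2
    ring
  simp_rw [h3]
  rw [lintegral_lintegral_swap hm2.aemeasurable]
  refine lintegral_congr fun x => ?_
  rw [lintegral_const_mul _ (by
    refine Measurable.ennreal_ofReal (Continuous.measurable ?_)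
    fun_prop)]
  congr 1
  have hpos : 0 ≤ ((m : ℝ) + 1)⁻¹ := by positivity
  simp_rw [ENNReal.ofReal_mul hpos]
  rw [lintegral_const_mul' _ _ ENNReal.ofReal_ne_top, lintegral_jetIntegrand,
    integral_jetIntegrand_eq m hz, ← ENNReal.ofReal_mul hpos, jetDensity_zero]
  congr 1
  field_simp

theorem lintegral_critValueMeasure_su2Poly {Ω : Type*} [MeasurableSpace Ω] (P : Measure Ω)
    [IsProbabilityMeasure P] (a : ℕ → Ω → ℂ) (ha_indep : iIndepFun a P)
    (ha_law : ∀ j, HasLaw (a j) stdComplexGaussian P) (m : ℕ) {f : ℂ → ℝ≥0∞}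
    (hf : Measurable f) :
    AEMeasurable (fun ω => ∫⁻ w, f w ∂critValueMeasure (su2Poly (m + 1) fun j => a j ω)) P ∧
    ∫⁻ ω, ∫⁻ w, f w ∂critValueMeasure (su2Poly (m + 1) fun j => a j ω) ∂P
      = ∫⁻ z : ℂ, ∫⁻ x : ℂ, f x * ENNReal.ofReal (kacRice m (‖z‖ ^ 2) (‖x‖ ^ 2)) := by
  obtain ⟨hmeas, hmap⟩ := map_splitCoeffs P a ha_indep ha_law m
  obtain ⟨h1, h2⟩ := lintegral_sum_critValue m hf
  rw [← hmap] at h1 h2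
  have hne : ∀ᵐ ω ∂P, a 1 ω ≠ 0 := by
    have hγ : stdComplexGaussian {0} = 0 :=
      withDensity_absolutelyContinuous _ _ (by simp)
    have := (ha_law 1).map_eq
    rw [← this, Measure.map_apply_of_aemeasurable (ha_law 1).aemeasurable
      (measurableSet_singleton 0)] at hγ
    exact measure_eq_zero_iff_ae_notMem.1 hγ
  have hae : (fun ω => ∫⁻ w, f w ∂critValueMeasure (su2Poly (m + 1) fun j => a j ω)) =ᵐ[P]
      (fun y : ℂ × (Fin m → ℂ) × ℂ =>
        ∑' z : {z | critCoeff m (z, y.2) = y.1}, f (critValue m (z, y.2)))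
        ∘ fun ω => splitCoeffs m fun j => a j ω :=
    hne.mono fun ω hω => lintegral_critValueMeasure m hω hf
  refine ⟨(h1.comp_aemeasurable hmeas).congr hae.symm, ?_⟩
  rw [lintegral_congr_ae hae, ← h2, lintegral_map' h1 hmeas]
  rfl

/-! ### Radial integration, the scale t = n|z|², and domination. -/

theorem integrable_comp_norm_sq_complex {g : ℝ → ℝ} (hg : IntegrableOn g (Set.Ioi 0)) :
    Integrable fun z : ℂ => g (‖z‖ ^ 2) := by
  rw [integrable_fun_norm_addHaar volume (f := fun y => g (y ^ 2))]
  have h := ((integrableOn_Ioi_comp_rpow_iff g (p := 2) (by norm_num)).2 hg).const_mul (1 / 2)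
  refine IntegrableOn.congr_fun (f := fun y => 1 / 2 * ((|2| * y ^ ((2 : ℝ) - 1)) • g (y ^ (2 : ℝ))))
    h (fun y _ => ?_) measurableSet_Ioi
  norm_num [Complex.finrank_real_complex]
  ring

theorem integral_comp_norm_sq_complex (g : ℝ → ℝ) :
    ∫ z : ℂ, g (‖z‖ ^ 2) = Real.pi * ∫ r in Set.Ioi 0, g r := by
  rw [integral_fun_norm_addHaar volume (fun y => g (y ^ 2)),
    ← integral_comp_rpow_Ioi_of_pos (g := g) (p := 2) (by norm_num), Complex.finrank_real_complex]
  have hv : (volume : Measure ℂ).real (Metric.ball 0 1) = Real.pi := by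
    simp [Measure.real, Complex.volume_ball]
  rw [hv, smul_eq_mul, nsmul_eq_mul, mul_left_comm, ← integral_const_mul]
  congr 1
  refine setIntegral_congr_fun measurableSet_Ioi fun y _ => ?_
  norm_num
  ring

/-- The Kac-Rice integrand in the variable `t = n |z|²`. -/
def scaledKacRice (m : ℕ) (t c : ℝ) : ℝ :=
  Real.pi⁻¹ * (m / (m + 1)) * (m / (m + 1) * t ^ 2 * c + 2 * (1 + t / (m + 1)) ^ (m + 1))
    / (((1 + t / (m + 1)) ^ (m + 1)) ^ 2 * (1 + t / (m + 1)) ^ 2)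
    * Real.exp (-((1 + t) * c / (1 + t / (m + 1)) ^ (m + 1)))

theorem scaledKacRice_eq (m : ℕ) (t c : ℝ) :
    scaledKacRice m t c = Real.pi / (m + 1) * kacRice m ((m + 1 : ℝ)⁻¹ * t) c := by
  have h : (m + 1 : ℝ)⁻¹ * t = t / (m + 1) := by ring
  rw [scaledKacRice, kacRice, h]
  have h2 : (m + 1 : ℝ) * (t / (m + 1)) = t := by field_simp
  rw [h2]
  field_simp

theorem scaledKacRice_nonneg (m : ℕ) {t c : ℝ} (ht : 0 ≤ t) (hc : 0 ≤ c) :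
    0 ≤ scaledKacRice m t c := by
  unfold scaledKacRice; positivity

/-- Bernoulli's inequality with exponent (m + 1)/2, then squaring; the exponent is at least 1
exactly when m ≥ 1. -/
theorem sq_le_one_add_div_pow {m : ℕ} (hm : 1 ≤ m) {t : ℝ} (ht : 0 ≤ t) :
    (1 + t / 2) ^ 2 ≤ (1 + t / (m + 1)) ^ (m + 1) := by
  have h1 : (1 : ℝ) ≤ (m + 1 : ℝ) / 2 := by
    have : (1 : ℝ) ≤ m := by exact_mod_cast hm
    linarith
  have h0 : 0 ≤ t / (m + 1 : ℝ) := by positivity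
  have h2 := one_add_mul_self_le_rpow_one_add (s := t / (m + 1 : ℝ)) (by linarith) h1
  have h3 : (m + 1 : ℝ) / 2 * (t / (m + 1)) = t / 2 := by field_simp
  rw [h3] at h2
  have h4 : ((1 + t / (m + 1 : ℝ)) ^ ((m + 1 : ℝ) / 2)) ^ 2 = (1 + t / (m + 1)) ^ (m + 1) := by
    rw [← Real.rpow_natCast, ← Real.rpow_mul (by positivity), ← Real.rpow_natCast]
    congr 1
    push_cast
    ring
  rw [← h4]
  exact pow_le_pow_left₀ (by positivity) h2 2

/-- Let W = (1 + t/n)^n ≥ (1 + t/2)². Then t² ≤ 4W cancels one power of W, and 1/W ≤ 4(1 + t)⁻². For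
m = 0 the integrand vanishes. A bound through `K` rather than `c` stays uniform for x in a
neighbourhood, as continuity in x requires. -/
theorem scaledKacRice_le (m : ℕ) {t c K : ℝ} (ht : 0 ≤ t) (hc : 0 ≤ c) (hcK : c ≤ K) :
    scaledKacRice m t c ≤ (4 * K + 2) * 4 * (1 + ‖t‖) ^ (-2 : ℝ) := by
  have hK : 0 ≤ K := hc.trans hcK
  rcases Nat.eq_zero_or_pos m with rfl | hm
  · simp only [scaledKacRice, CharP.cast_eq_zero, zero_div, mul_zero, zero_mul]
    positivity
  have hW := sq_le_one_add_div_pow hm ht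
  have hW1 : 1 ≤ 1 + t / (m + 1 : ℝ) := by
    have : 0 ≤ t / (m + 1 : ℝ) := by positivity
    linarith
  rw [scaledKacRice]
  set W := (1 + t / (m + 1 : ℝ)) ^ (m + 1)
  have hWpos : 0 < W := lt_of_lt_of_le (by positivity) hW
  have hq : (m : ℝ) / (m + 1) ≤ 1 := by
    rw [div_le_one (by positivity)]; linarith
  have hpi : Real.pi⁻¹ ≤ 1 := inv_le_one_of_one_le₀ (by linarith [Real.pi_gt_three])
  have hexp : Real.exp (-((1 + t) * c / W)) ≤ 1 := by
    rw [Real.exp_le_one_iff]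
    have : 0 ≤ (1 + t) * c / W := by positivity
    linarith
  have hpref : Real.pi⁻¹ * (m / (m + 1)) ≤ 1 := mul_le_one₀ hpi (by positivity) hq
  have h1 : Real.pi⁻¹ * (m / (m + 1)) * (m / (m + 1) * t ^ 2 * c + 2 * W)
      / (W ^ 2 * (1 + t / (m + 1)) ^ 2) ≤ (t ^ 2 * K + 2 * W) / W ^ 2 := by
    have hnum : Real.pi⁻¹ * (m / (m + 1)) * (m / (m + 1) * t ^ 2 * c + 2 * W)
        ≤ t ^ 2 * K + 2 * W := by
      refine (mul_le_of_le_one_left (by positivity) hpref).trans ?_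
      have : (m : ℝ) / (m + 1) * t ^ 2 * c ≤ t ^ 2 * K :=
        mul_le_mul (mul_le_of_le_one_left (by positivity) hq) hcK hc (by positivity)
      linarith
    have hden : W ^ 2 ≤ W ^ 2 * (1 + t / (m + 1)) ^ 2 :=
      le_mul_of_one_le_right (by positivity) (one_le_pow₀ hW1)
    exact div_le_div₀ (by positivity) hnum (by positivity) hden
  have h2 : (t ^ 2 * K + 2 * W) / W ^ 2 ≤ (4 * K + 2) / W := by
    rw [div_le_div_iff₀ (by positivity) hWpos]
    have h3 : t ^ 2 ≤ 4 * W := by nlinarith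
    have h4 : t ^ 2 * K ≤ 4 * W * K := mul_le_mul_of_nonneg_right h3 hK
    nlinarith
  have h5 : (4 * K + 2) / W ≤ (4 * K + 2) * 4 * (1 + ‖t‖) ^ (-2 : ℝ) := by
    rw [Real.norm_of_nonneg ht, Real.rpow_neg (by positivity), Real.rpow_two, mul_assoc,
      div_eq_mul_inv]
    refine mul_le_mul_of_nonneg_left ?_ (by positivity)
    rw [inv_le_iff_one_le_mul₀ hWpos, mul_comm 4, mul_assoc, ← div_eq_inv_mul,
      le_div_iff₀ (by positivity)]
    nlinarith
  calc _ ≤ _ := mul_le_of_le_one_right (by positivity) hexp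
    _ ≤ _ := h1.trans (h2.trans h5)

theorem measurable_scaledKacRice (m : ℕ) (c : ℝ) : Measurable fun t => scaledKacRice m t c := by
  unfold scaledKacRice; fun_prop

theorem integrable_scaledKacRice_bound (K : ℝ) :
    Integrable (fun t : ℝ => (4 * K + 2) * 4 * (1 + ‖t‖) ^ (-2 : ℝ))
      (volume.restrict (Set.Ioi 0)) :=
  ((integrable_one_add_norm (by simp)).const_mul _).integrableOn

theorem norm_scaledKacRice_le {c K : ℝ} (hc : 0 ≤ c) (hcK : c ≤ K) (m : ℕ) :
    ∀ᵐ t ∂(volume.restrict (Set.Ioi (0 : ℝ))),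
      ‖scaledKacRice m t c‖ ≤ (4 * K + 2) * 4 * (1 + ‖t‖) ^ (-2 : ℝ) := by
  refine (ae_restrict_iff' measurableSet_Ioi).2 (ae_of_all _ fun t ht => ?_)
  rw [Real.norm_of_nonneg (scaledKacRice_nonneg m (le_of_lt ht) hc)]
  exact scaledKacRice_le m (le_of_lt ht) hc hcK

theorem integrableOn_scaledKacRice (m : ℕ) {c : ℝ} (hc : 0 ≤ c) :
    IntegrableOn (fun t => scaledKacRice m t c) (Set.Ioi 0) :=
  (integrable_scaledKacRice_bound c).mono' (measurable_scaledKacRice m c).aestronglyMeasurable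
    (norm_scaledKacRice_le hc le_rfl m)

/-- The density of the expected empirical measure of critical values in degree `m + 1`. -/
def critDensity (m : ℕ) (x : ℂ) : ℝ := ∫ t in Set.Ioi (0 : ℝ), scaledKacRice m t (‖x‖ ^ 2)

theorem critDensity_nonneg (m : ℕ) (x : ℂ) : 0 ≤ critDensity m x :=
  setIntegral_nonneg measurableSet_Ioi fun _ ht =>
    scaledKacRice_nonneg m (le_of_lt ht) (by positivity)

theorem lintegral_kacRice (m : ℕ) (x : ℂ) :
    ∫⁻ z : ℂ, ENNReal.ofReal (kacRice m (‖z‖ ^ 2) (‖x‖ ^ 2)) = ENNReal.ofReal (critDensity m x) := by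
  set c := ‖x‖ ^ 2 with hc
  have hc0 : 0 ≤ c := by positivity
  have hm : (0 : ℝ) < (m + 1 : ℝ)⁻¹ := by positivity
  have hscale : ∀ t, kacRice m ((m + 1 : ℝ)⁻¹ * t) c
      = (m + 1) / Real.pi * scaledKacRice m t c := by
    intro t
    rw [scaledKacRice_eq]
    field_simp
  have hint : IntegrableOn (fun r => kacRice m r c) (Set.Ioi 0) := by
    have := (integrableOn_Ioi_comp_mul_left_iff (fun r => kacRice m r c) 0 hm).1
    rw [mul_zero] at this
    refine this ?_
    simp_rw [hscale]
    exact (integrableOn_scaledKacRice m hc0).const_mul _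
  have hval : ∫ r in Set.Ioi 0, kacRice m r c = Real.pi⁻¹ * critDensity m x := by
    have h := integral_comp_mul_left_Ioi (fun r => kacRice m r c) 0 hm
    simp_rw [hscale] at h
    rw [integral_const_mul, mul_zero, inv_inv, smul_eq_mul] at h
    rw [critDensity, ← hc]
    field_simp at h ⊢
    linarith
  rw [← ofReal_integral_eq_lintegral_ofReal (integrable_comp_norm_sq_complex hint)
    (ae_of_all _ fun z => by simp only [kacRice, Pi.zero_apply]; positivity),
    integral_comp_norm_sq_complex (fun r => kacRice m r c), hval]
  congr 1
  field_simp

theorem continuous_critDensity (m : ℕ) : Continuous (critDensity m) := by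
  refine continuous_iff_continuousAt.2 fun x₀ => ?_
  refine continuousAt_of_dominated (bound := fun t => (4 * (‖x₀‖ ^ 2 + 1) + 2) * 4
      * (1 + ‖t‖) ^ (-2 : ℝ))
    (Eventually.of_forall fun x => (measurable_scaledKacRice m _).aestronglyMeasurable) ?_
    (integrable_scaledKacRice_bound _) (ae_of_all _ fun t => ?_)
  · have h : Tendsto (fun x : ℂ => ‖x‖ ^ 2) (𝓝 x₀) (𝓝 (‖x₀‖ ^ 2)) :=
      (by fun_prop : Continuous fun x : ℂ => ‖x‖ ^ 2).tendsto x₀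
    filter_upwards [h.eventually (ge_mem_nhds (lt_add_one _))] with x hx
    exact norm_scaledKacRice_le (by positivity) hx m
  · unfold scaledKacRice
    refine Continuous.continuousAt ?_
    simp only [div_eq_mul_inv]
    fun_prop

/-! ### The limit integrand and its integral. -/

/-- The pointwise limit of `scaledKacRice`. -/
def limitKacRice (t c : ℝ) : ℝ :=
  Real.pi⁻¹ * ((t ^ 2 * c + 2 * Real.exp t) / Real.exp t ^ 2 * Real.exp (-((1 + t) * c / Real.exp t)))

theorem tendsto_scaledKacRice (t c : ℝ) :
    Tendsto (fun m => scaledKacRice m t c) atTop (𝓝 (limitKacRice t c)) := by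
  have hq : Tendsto (fun m : ℕ => (m : ℝ) / (m + 1)) atTop (𝓝 1) := tendsto_natCast_div_add_atTop 1
  have hW : Tendsto (fun m : ℕ => (1 + t / (m + 1 : ℝ)) ^ (m + 1)) atTop (𝓝 (Real.exp t)) := by
    have := (Real.tendsto_one_add_div_pow_exp t).comp (tendsto_add_atTop_nat 1)
    refine this.congr fun m => ?_
    simp
  have h1 : Tendsto (fun m : ℕ => 1 + t / (m + 1 : ℝ)) atTop (𝓝 1) := by
    have : Tendsto (fun m : ℕ => t / (m + 1 : ℝ)) atTop (𝓝 0) :=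
      tendsto_const_nhds.div_atTop
        (tendsto_atTop_add_const_right _ _ tendsto_natCast_atTop_atTop)
    simpa using this.const_add 1
  have hexp : Real.exp t ≠ 0 := (Real.exp_pos t).ne'
  have h2 : Tendsto (fun m : ℕ => Real.exp (-((1 + t) * c / (1 + t / (m + 1 : ℝ)) ^ (m + 1)))) atTop
      (𝓝 (Real.exp (-((1 + t) * c / Real.exp t)))) :=
    (Real.continuous_exp.tendsto _).comp ((tendsto_const_nhds.div hW hexp).neg)
  have h3 := ((((hq.const_mul Real.pi⁻¹).mul
    (((hq.mul_const (t ^ 2)).mul_const c).add (hW.const_mul 2))).div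
      ((hW.pow 2).mul (h1.pow 2)) (by positivity)).mul h2)
  have e : limitKacRice t c = Real.pi⁻¹ * 1 * (1 * t ^ 2 * c + 2 * Real.exp t)
      / (Real.exp t ^ 2 * 1 ^ 2) * Real.exp (-((1 + t) * c / Real.exp t)) := by
    rw [limitKacRice]; ring
  rw [e]
  exact h3

theorem tendsto_critDensity (x : ℂ) :
    Tendsto (fun m => critDensity m x) atTop
      (𝓝 (∫ t in Set.Ioi (0 : ℝ), limitKacRice t (‖x‖ ^ 2))) :=
  tendsto_integral_of_dominated_convergence _
    (fun m => (measurable_scaledKacRice m _).aestronglyMeasurable)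
    (integrable_scaledKacRice_bound (‖x‖ ^ 2))
    (fun m => norm_scaledKacRice_le (by positivity) le_rfl m)
    (ae_of_all _ fun t => tendsto_scaledKacRice t _)

/-- `exp (-(s - s log s) c)` at `s = exp (-t)`. -/
def expWeight (c t : ℝ) : ℝ := Real.exp (-((1 + t) * Real.exp (-t) * c))

theorem hasDerivAt_expWeight (c t : ℝ) :
    HasDerivAt (expWeight c) (t * Real.exp (-t) * c * expWeight c t) t := by
  have h1 : HasDerivAt (fun t : ℝ => Real.exp (-t)) (Real.exp (-t) * -1) t :=
    (hasDerivAt_neg t).exp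
  have h2 := ((((hasDerivAt_id t).const_add 1).mul h1).mul_const c).neg.exp
  refine h2.congr_deriv ?_
  simp only [expWeight, id, Pi.mul_apply, Pi.neg_apply]
  ring

theorem tendsto_expWeight (c : ℝ) : Tendsto (expWeight c) atTop (𝓝 1) := by
  have h0 := Real.tendsto_pow_mul_exp_neg_atTop_nhds_zero 0
  have h1 := Real.tendsto_pow_mul_exp_neg_atTop_nhds_zero 1
  have h2 := (Real.continuous_exp.tendsto _).comp (((h0.add h1).mul_const c).neg)
  simp only [add_zero, zero_mul, neg_zero, Real.exp_zero] at h2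
  refine h2.congr fun t => ?_
  simp only [expWeight, Function.comp_apply]
  ring_nf

theorem expWeight_pos (c t : ℝ) : 0 < expWeight c t := Real.exp_pos _

/-- Substitute s = exp(-t), for which s - s log s = (1 + t) exp(-t). -/
theorem integral_exp_neg_mul_expWeight (c : ℝ) :
    ∫ t in Set.Ioi (0 : ℝ), Real.exp (-t) * expWeight c t
      = ∫ s in (0 : ℝ)..1, Real.exp (-(s - s * Real.log s) * c) := by
  have hder : ∀ t ∈ Set.Ioi (0 : ℝ), HasDerivWithinAt (fun t : ℝ => Real.exp (-t))
      (Real.exp (-t) * -1) (Set.Ioi 0) t := fun t _ => (hasDerivAt_neg t).exp.hasDerivWithinAt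
  have hinj : Set.InjOn (fun t : ℝ => Real.exp (-t)) (Set.Ioi 0) := by
    intro a _ b _ h
    simpa using h
  have himg : (fun t : ℝ => Real.exp (-t)) '' Set.Ioi 0 = Set.Ioo 0 1 := by
    ext s
    constructor
    · rintro ⟨t, ht, rfl⟩
      exact ⟨Real.exp_pos _, by simpa using ht⟩
    · rintro ⟨h0, h1⟩
      exact ⟨-Real.log s, neg_pos.2 (Real.log_neg h0 h1), by simp [Real.exp_log h0]⟩
  have h := integral_image_eq_integral_abs_deriv_smul measurableSet_Ioi hder hinj
    fun s => Real.exp (-(s - s * Real.log s) * c)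
  rw [intervalIntegral.integral_of_le zero_le_one, integral_Ioc_eq_integral_Ioo, ← himg, h]
  refine setIntegral_congr_fun measurableSet_Ioi fun t _ => ?_
  simp only [mul_neg, mul_one, abs_neg, abs_of_pos (Real.exp_pos _), smul_eq_mul, Real.log_exp,
    expWeight]
  ring_nf

theorem integrableOn_exp_neg_mul_expWeight {c : ℝ} (hc : 0 ≤ c) :
    IntegrableOn (fun t => Real.exp (-t) * expWeight c t) (Set.Ioi 0) := by
  refine (integrableOn_exp_neg_Ioi 0).mono' ?_ ?_
  · exact (by unfold expWeight; fun_prop : Continuous fun t =>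
      Real.exp (-t) * expWeight c t).aestronglyMeasurable
  · refine (ae_restrict_iff' measurableSet_Ioi).2 (ae_of_all _ fun t ht => ?_)
    rw [Real.norm_of_nonneg (mul_pos (Real.exp_pos _) (expWeight_pos c t)).le]
    refine mul_le_of_le_one_right (Real.exp_pos _).le (Real.exp_le_one_iff.2 ?_)
    have ht' : (0 : ℝ) < t := ht
    have : 0 ≤ (1 + t) * Real.exp (-t) * c := by positivity
    linarith

/-- An antiderivative of the remaining part of the limit integrand. -/
theorem hasDerivAt_antiderivative {c : ℝ} (hc : c ≠ 0) (t : ℝ) :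
    HasDerivAt (fun t => t * Real.exp (-t) * expWeight c t + expWeight c t / c)
      ((t ^ 2 * c * Real.exp (-t) ^ 2 + Real.exp (-t)) * expWeight c t) t := by
  have h1 : HasDerivAt (fun t : ℝ => Real.exp (-t)) (Real.exp (-t) * -1) t :=
    (hasDerivAt_neg t).exp
  have h2 := (((hasDerivAt_id t).mul h1).mul (hasDerivAt_expWeight c t)).add
    ((hasDerivAt_expWeight c t).div_const c)
  refine h2.congr_deriv ?_
  simp only [id, Pi.mul_apply]
  field_simp
  ring

theorem tendsto_antiderivative (c : ℝ) :
    Tendsto (fun t => t * Real.exp (-t) * expWeight c t + expWeight c t / c) atTop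
      (𝓝 (1 / c)) := by
  have h1 := Real.tendsto_pow_mul_exp_neg_atTop_nhds_zero 1
  simp only [pow_one] at h1
  simpa using (h1.mul (tendsto_expWeight c)).add ((tendsto_expWeight c).div_const c)

/-- The antiderivative runs from exp(-c)/c at 0 to 1/c at infinity, and nonnegativity of the
integrand gives integrability as well. It divides by c, so c = 0 is separate. -/
theorem integral_sq_mul_expWeight {c : ℝ} (hc : 0 ≤ c) :
    IntegrableOn (fun t => (t ^ 2 * c * Real.exp (-t) ^ 2 + Real.exp (-t)) * expWeight c t)
      (Set.Ioi 0) ∧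
    ∫ t in Set.Ioi (0 : ℝ), (t ^ 2 * c * Real.exp (-t) ^ 2 + Real.exp (-t)) * expWeight c t
      = if c = 0 then 1 else (1 - Real.exp (-c)) / c := by
  by_cases h0 : c = 0
  · subst h0
    have he : ∀ t : ℝ, (t ^ 2 * 0 * Real.exp (-t) ^ 2 + Real.exp (-t)) * expWeight 0 t
        = Real.exp (-t) := by
      intro t; simp [expWeight]
    simp_rw [he]
    exact ⟨integrableOn_exp_neg_Ioi 0, by simpa using integral_exp_neg_Ioi_zero⟩
  · have hpos : ∀ t ∈ Set.Ioi (0 : ℝ),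
        0 ≤ (t ^ 2 * c * Real.exp (-t) ^ 2 + Real.exp (-t)) * expWeight c t := by
      intro t _
      have := expWeight_pos c t
      positivity
    refine ⟨integrableOn_Ioi_deriv_of_nonneg' (fun t _ => hasDerivAt_antiderivative h0 t) hpos
      (tendsto_antiderivative c), ?_⟩
    rw [integral_Ioi_of_hasDerivAt_of_nonneg' (fun t _ => hasDerivAt_antiderivative h0 t) hpos
      (tendsto_antiderivative c), if_neg h0]
    simp [expWeight, sub_div]

/-- Of the two copies of exp(-t) multiplying `expWeight`, one completes the quadratic term to an
exact derivative and the other gives the integral over [0, 1]. -/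
theorem integral_limitKacRice {c : ℝ} (hc : 0 ≤ c) :
    ∫ t in Set.Ioi (0 : ℝ), limitKacRice t c
      = Real.pi⁻¹ * ((if c = 0 then 1 else (1 - Real.exp (-c)) / c)
        + ∫ s in (0 : ℝ)..1, Real.exp (-(s - s * Real.log s) * c)) := by
  obtain ⟨hi, hv⟩ := integral_sq_mul_expWeight hc
  rw [← hv, ← integral_exp_neg_mul_expWeight,
    ← integral_add hi (integrableOn_exp_neg_mul_expWeight hc), ← integral_const_mul]
  refine setIntegral_congr_fun measurableSet_Ioi fun t _ => ?_
  simp only [limitKacRice, expWeight, Real.exp_neg t]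
  have he : Real.exp t ≠ 0 := (Real.exp_pos t).ne'
  rw [show (1 + t) * (Real.exp t)⁻¹ * c = (1 + t) * c / Real.exp t by field_simp]
  field_simp
  ring

/-! ### Test functions, uniqueness, and the theorem. -/

theorem lintegral_critValueMeasure_eq_lintegral_critDensity {Ω : Type*} [MeasurableSpace Ω]
    (P : Measure Ω) [IsProbabilityMeasure P] (a : ℕ → Ω → ℂ) (ha_indep : iIndepFun a P)
    (ha_law : ∀ j, HasLaw (a j) stdComplexGaussian P) (m : ℕ) {f : ℂ → ℝ≥0∞}
    (hf : Measurable f) :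
    AEMeasurable (fun ω => ∫⁻ w, f w ∂critValueMeasure (su2Poly (m + 1) fun j => a j ω)) P ∧
    ∫⁻ ω, ∫⁻ w, f w ∂critValueMeasure (su2Poly (m + 1) fun j => a j ω) ∂P
      = ∫⁻ x, f x * ENNReal.ofReal (critDensity m x) := by
  obtain ⟨h1, h2⟩ := lintegral_critValueMeasure_su2Poly P a ha_indep ha_law m hf
  refine ⟨h1, h2.trans ?_⟩
  have hk : Measurable fun q : ℂ × ℂ => kacRice m (‖q.1‖ ^ 2) (‖q.2‖ ^ 2) := by
    unfold kacRice; fun_prop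
  rw [lintegral_lintegral_swap ((hf.comp measurable_snd).mul hk.ennreal_ofReal).aemeasurable]
  refine lintegral_congr fun x => ?_
  rw [← lintegral_kacRice]
  exact lintegral_const_mul _ (hk.comp measurable_prodMk_right).ennreal_ofReal

theorem integrable_critValueMeasure (p : ℂ[X]) (φ : ℂ → ℝ) :
    Integrable φ (critValueMeasure p) := by
  unfold critValueMeasure
  exact integrable_finsetSum_measure.2 fun z _ => integrable_dirac (by simp)

/-- The nonnegative formula is applied to the positive and negative parts of φ. Both are finite
since the density is continuous and φ has compact support; this also yields integrability of the
random sum. -/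
theorem isExpectedCritDensity_critDensity {Ω : Type*} [MeasurableSpace Ω]
    (P : Measure Ω) [IsProbabilityMeasure P] (a : ℕ → Ω → ℂ) (ha_indep : iIndepFun a P)
    (ha_law : ∀ j, HasLaw (a j) stdComplexGaussian P) (m : ℕ) :
    IsExpectedCritDensity P (fun ω => su2Poly (m + 1) fun j => a j ω) (critDensity m) := by
  refine ⟨(continuous_critDensity m).locallyIntegrable, fun φ hφ hφc => ?_⟩
  have hφcont : Continuous φ := hφ.continuous
  have hint : Integrable (fun x => φ x * critDensity m x) :=
    (hφcont.mul (continuous_critDensity m)).integrable_of_hasCompactSupport hφc.mul_right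
  obtain ⟨hm1, hv1⟩ := lintegral_critValueMeasure_eq_lintegral_critDensity P a ha_indep ha_law m
    hφcont.measurable.ennreal_ofReal
  obtain ⟨hm2, hv2⟩ := lintegral_critValueMeasure_eq_lintegral_critDensity P a ha_indep ha_law m
    hφcont.neg.measurable.ennreal_ofReal
  simp only [Pi.neg_apply] at hm2
  simp only [← ENNReal.ofReal_mul' (critDensity_nonneg m _), Pi.neg_apply, neg_mul] at hv1 hv2
  have hf1 : ∫⁻ x, ENNReal.ofReal (φ x * critDensity m x) ≠ ∞ := hint.lintegral_lt_top.ne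
  have hf2 : ∫⁻ x, ENNReal.ofReal (-(φ x * critDensity m x)) ≠ ∞ := hint.neg.lintegral_lt_top.ne
  rw [← hv1] at hf1
  rw [← hv2] at hf2
  have hi1 := integrable_toReal_of_lintegral_ne_top hm1 hf1
  have hi2 := integrable_toReal_of_lintegral_ne_top hm2 hf2
  have hsplit : ∀ ω, ∫ w, φ w ∂critValueMeasure (su2Poly (m + 1) fun j => a j ω)
      = (∫⁻ w, ENNReal.ofReal (φ w) ∂critValueMeasure (su2Poly (m + 1) fun j => a j ω)).toReal
        - (∫⁻ w, ENNReal.ofReal (-φ w)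
          ∂critValueMeasure (su2Poly (m + 1) fun j => a j ω)).toReal := fun ω =>
    integral_eq_lintegral_pos_part_sub_lintegral_neg_part (integrable_critValueMeasure _ φ)
  simp_rw [hsplit]
  refine ⟨hi1.sub hi2, ?_⟩
  rw [integral_sub hi1 hi2, integral_toReal hm1 (ae_lt_top' hm1 hf1),
    integral_toReal hm2 (ae_lt_top' hm2 hf2), hv1, hv2,
    integral_eq_lintegral_pos_part_sub_lintegral_neg_part hint]

theorem IsExpectedCritDensity.eq_of_continuous {Ω : Type*} [MeasurableSpace Ω] {P : Measure Ω}
    {p : Ω → ℂ[X]} {D D' : ℂ → ℝ} (h : IsExpectedCritDensity P p D)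
    (h' : IsExpectedCritDensity P p D') (hD : Continuous D) (hD' : Continuous D') : D = D' := by
  refine (Continuous.ae_eq_iff_eq (volume : Measure ℂ) hD hD').1 ?_
  refine ae_eq_of_integral_contDiff_smul_eq h.1 h'.1 fun φ hφ hφc => ?_
  simp only [smul_eq_mul]
  rw [← (h.2 φ hφ hφc).2, ← (h'.2 φ hφ hφc).2]

end

/-- For i.i.d. standard complex Gaussian coefficients, the expected empirical measure of critical
values of the `SU(2)` polynomial `p_n` has (for each `n ≥ 1`) a continuous density, and these
densities converge pointwise. The first term of the limit is read at `x = 0` as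
its limit `1 / π`. -/
theorem theorem1p1 {Ω : Type*} [MeasurableSpace Ω] (P : Measure Ω) [IsProbabilityMeasure P]
    (a : ℕ → Ω → ℂ) (ha_indep : iIndepFun a P)
    (ha_law : ∀ j, HasLaw (a j) stdComplexGaussian P) :
    (∀ n : ℕ, 1 ≤ n → ∃ D : ℂ → ℝ, Continuous D ∧
      IsExpectedCritDensity P (fun ω => su2Poly n (fun j => a j ω)) D) ∧
    (∀ D : ℕ → ℂ → ℝ,
      (∀ n : ℕ, 1 ≤ n → Continuous (D n) ∧
        IsExpectedCritDensity P (fun ω => su2Poly n (fun j => a j ω)) (D n)) →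
      ∀ x : ℂ, Tendsto (fun n => D n x) atTop
        (𝓝 ((if x = 0 then 1 / Real.pi
              else (1 - Real.exp (-‖x‖ ^ 2)) / (Real.pi * ‖x‖ ^ 2)) +
            1 / Real.pi *
              ∫ s in (0 : ℝ)..1, Real.exp (-(s - s * Real.log s) * ‖x‖ ^ 2)))) := by
  have hdens := isExpectedCritDensity_critDensity P a ha_indep ha_law
  constructor
  · intro n hn
    obtain ⟨m, rfl⟩ := Nat.exists_eq_add_of_le' hn
    exact ⟨critDensity m, continuous_critDensity m, hdens m⟩
  · intro D hD x
    have hDm : ∀ m, D (m + 1) = critDensity m := fun m =>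
      (hD (m + 1) (Nat.le_add_left 1 m)).2.eq_of_continuous (hdens m)
        (hD (m + 1) (Nat.le_add_left 1 m)).1 (continuous_critDensity m)
    -- `D 0` is unconstrained, so the limit is taken along n = m + 1.
    refine (tendsto_add_atTop_iff_nat 1).1 ?_
    simp_rw [hDm]
    convert tendsto_critDensity x using 2
    rw [integral_limitKacRice (by positivity), mul_add, one_div]
    congr 1
    by_cases hx : x = 0
    · simp [hx]
    · have hx' : ‖x‖ ^ 2 ≠ 0 := by simpa using hx
      rw [if_neg hx, if_neg hx']
      field_simp
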